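/- Let $k$ be a field of characteristic $p\ge 3$. Let $k[Y]$ be the polynomial Hopf algebra with $Y$ primitive, and let $H_4$ be Sweedler's Hopf algebra, with basis $1,g,x,gx$, relations $g^2=1$, $x^2=0$, $xg=-gx$, and with $\Delta(g)=g\otimes g$, $\Delta(x)=x\otimes 1+g\otimes x$. For Hopf algebras $A,H$ over $k$, a crossed system $(A,H,\triangleright,f)$ consists of a weak action $\triangleright:H\otimes A\to A$ (a linear map with $h\triangleright 1=\varepsilon(h)1$, $1\triangleright a=a$, $h\triangleright(ab)=(h_{(1)}\triangleright a)(h_{(2)}\triangleright b)$) and a linear map $f:H\otimes H\to A$ such that $A\otimes H$ with multiplication $(a\# h)(c\# h')=a(h_{(1)}\triangleright c)f(h_{(2)},h'_{(1)})\# h_{(3)}h'_{(2)}$, unit $1\#1$ and the tensor product coalgebra structure is a Hopf algebra; this Hopf algebra is called a crossed product $A\# H$. Let $\mathrm{Crp}(H,A)$ be the set of Hopf algebra isomorphism types of all crossed products $A\# H$. Two crossed systems $(\triangleright,f)$, $(\triangleright',f')$ are cohomologous if there is a coalgebra map $r:H\to A$ with $r(1)=1$ and $r(h_{(1)})\otimes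 h_{(2)}=r(h_{(2)})\otimes h_{(1)}$ for all $h \in H$, such that $h\triangleright' a=r(h_{(1)})(h_{(2)}\triangleright a)S(r(h_{(3)}))$ and $f'(h,h')=r(h_{(1)})(h_{(2)}\triangleright r(h'_{(1)}))f(h_{(3)},h'_{(2)})S(r(h_{(4)}h'_{(3)}))$ for all $a \in A$ and $h, h' \in H$; $\mathcal H^2(H,A)$ is the set of crossed systems modulo this relation. Let $k^{(\mathbb N)}$ be the set of finitely supported sequences $(\alpha_i)_{i\ge0}$ in $k$. Let $A_{((\alpha_i))}$ be the Hopf algebra generated by $Y,g,x$ subject to $$g^2=1,\quad x^2=\sum_{i\ge 0}\alpha_iY^{p^i},\quad xg=-gx,\quad gY=Yg,\quad xY=Yx,$$ with $Y$ primitive, $g$ group-like and $\Delta(x)=x\otimes1+g\otimes x$. Let $G((\alpha_i))=\{(a,b)\in k^*\times k^*: a^{p^i}=b^2\text{ for all } i \text{ with }\alpha_i\ne0\}$. Then: (1) A Hopf algebra $E$ over $k$ is isomorphic, as a Hopf algebra, to a crossed product $k[Y]\# H_4$ if and only if $E\cong A_{((\alpha_i))}$ for some $(\alpha_i)\in k^{(\mathbb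 N)}$. Every $A_{((\alpha_i))}$ is infinite dimensional over $k$, and $A_{(0)}\cong k[Y]\otimes H_4$ as Hopf algebras. There are group isomorphisms $\mathrm{Aut}_{\mathrm{Hopf}}(k[Y]\otimes H_4)\cong k^*\times k^*$ and $\mathrm{Aut}_{\mathrm{Hopf}}(A_{((\alpha_i))})\cong G((\alpha_i))$ for every $(\alpha_i)\neq0$. (2) There is a bijection $\mathrm{Crp}(H_4,k[Y])\cong k^{(\mathbb N)}/\!\sim$, where $(\alpha_i)\sim(\beta_i)$ if and only if there are $a,b\in k^*$ with $a^{p^i}\alpha_i=b^2\beta_i$ for all $i\ge 0$; it sends the isomorphism type of $A_{((\alpha_i))}$ to the class of $(\alpha_i)$. (3) Being cohomologous is an equivalence relation on the crossed systems $(k[Y],H_4,\triangleright,f)$, and there is a bijection $\mathcal H^2(H_4,k[Y])\cong k^{(\mathbb N)}$; it sends the class of $(\triangleright,f)$ to the sequence $(\alpha_i)$ with $f(x,x)=\sum_{i\ge 0}\alpha_iY^{p^i}$. -/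

import Mathlib

open scoped TensorProduct Polynomial
open Coalgebra

noncomputable section

/-! ### Automorphism groups of Hopf algebras -/

/-- The group of Hopf algebra automorphisms of `A`, under composition. (A bialgebra map between
Hopf algebras automatically commutes with the antipodes, so isomorphisms of Hopf algebras are
Mathlib's `≃ₐc`.) -/
instance BialgEquiv.autGroup {k A : Type*} [CommSemiring k] [Semiring A] [Bialgebra k A] :
    Group (A ≃ₐc[k] A) where
  mul f g := g.trans f
  one := BialgEquiv.refl k A
  inv f := f.symm
  mul_assoc _ _ _ := rfl
  one_mul _ := rfl
  mul_one _ := rfl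
  inv_mul_cancel f := BialgEquiv.ext fun a => f.symm_apply_apply a

/-! ### Crossed products of Hopf algebras -/

section Crossed

variable {k A H : Type*} [Field k] [Ring A] [HopfAlgebra k A] [Ring H] [HopfAlgebra k H]

/-- Convolution `(φ * ψ)(c) = φ(c₍₁₎) ψ(c₍₂₎)` of linear maps from a coalgebra to an algebra. -/
def convMap {C : Type*} [AddCommGroup C] [Module k C] [Coalgebra k C] (φ ψ : C →ₗ[k] A) :
    C →ₗ[k] A :=
  (WithConv.toConv φ * WithConv.toConv ψ).ofConv

theorem convMap_eq {C : Type*} [AddCommGroup C] [Module k C] [Coalgebra k C]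
    (φ ψ : C →ₗ[k] A) :
    convMap φ ψ = LinearMap.mul' k A ∘ₗ TensorProduct.map φ ψ ∘ₗ comul := rfl

/-- The map `h ⊗ g ↦ φ(h) ε(g)`. -/
def extendByCounit (φ : H →ₗ[k] A) : H ⊗[k] H →ₗ[k] A :=
  (TensorProduct.rid k A).toLinearMap ∘ₗ TensorProduct.map φ counit

@[simp] theorem extendByCounit_tmul (φ : H →ₗ[k] A) (h g : H) :
    extendByCounit φ (h ⊗ₜ[k] g) = counit (R := k) g • φ h := by
  simp [extendByCounit]

/-- For `c : A`, the map `h ⊗ g ↦ (h₍₁₎ ▹ c) f(h₍₂₎, g₍₁₎) # h₍₃₎ g₍₂₎`. -/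
def crossedMulAux (act : H →ₗ[k] A →ₗ[k] A) (f : H ⊗[k] H →ₗ[k] A) (c : A) :
    H ⊗[k] H →ₗ[k] A ⊗[k] H :=
  TensorProduct.map (convMap (extendByCounit (act.flip c)) f) (LinearMap.mul' k H) ∘ₗ comul

/-- The multiplication
`(a # h)(c # g) = a (h₍₁₎ ▹ c) f(h₍₂₎, g₍₁₎) # h₍₃₎ g₍₂₎` on `A ⊗ H`. -/
def crossedMul (act : H →ₗ[k] A →ₗ[k] A) (f : H ⊗[k] H →ₗ[k] A) :
    A ⊗[k] H →ₗ[k] A ⊗[k] H →ₗ[k] A ⊗[k] H :=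
  TensorProduct.lift <| LinearMap.mk₂ k
    (fun a h => TensorProduct.lift <| LinearMap.mk₂ k
      (fun c g => (LinearMap.mulLeft k a).rTensor H (crossedMulAux act f c (h ⊗ₜ[k] g)))
      (by
        intro c c' g
        simp [crossedMulAux, convMap_eq, extendByCounit, TensorProduct.map_add_left,
          LinearMap.comp_add, LinearMap.add_comp])
      (by
        intro t c g
        simp [crossedMulAux, convMap_eq, extendByCounit, TensorProduct.map_smul_left,
          LinearMap.comp_smul, LinearMap.smul_comp])
      (by intro c g g'; rw [TensorProduct.tmul_add, map_add, map_add])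
      (by intro t c g; rw [TensorProduct.tmul_smul, map_smul, map_smul]))
    (by
      intro a a' h
      refine TensorProduct.ext' fun c g => ?_
      have : LinearMap.mulLeft k (a + a') = LinearMap.mulLeft k a + LinearMap.mulLeft k a' := by
        ext; simp [add_mul]
      simp [this, LinearMap.rTensor_add])
    (by
      intro t a h
      refine TensorProduct.ext' fun c g => ?_
      have : LinearMap.mulLeft k (t • a) = t • LinearMap.mulLeft k a := by
        ext; simp
      simp [this, LinearMap.rTensor_smul])
    (by
      intro a h h'
      refine TensorProduct.ext' fun c g => ?_
      simp [TensorProduct.add_tmul])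
    (by
      intro t a h
      refine TensorProduct.ext' fun c g => ?_
      simp [← TensorProduct.smul_tmul'])

theorem crossedMul_tmul (act : H →ₗ[k] A →ₗ[k] A) (f : H ⊗[k] H →ₗ[k] A) (a c : A) (h g : H) :
    crossedMul act f (a ⊗ₜ[k] h) (c ⊗ₜ[k] g) =
      (LinearMap.mulLeft k a).rTensor H (crossedMulAux act f c (h ⊗ₜ[k] g)) := by
  simp [crossedMul]

variable (k A H) in
/-- A crossed system of Hopf algebras `(A, H, ▹, f)`: a weak action `▹` of `H` on `A` and a linear
map `f : H ⊗ H → A` such that `A ⊗ H`, with the multiplication `crossedMul`, the unit `1 # 1` and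
the tensor product coalgebra structure, is a Hopf algebra. (Compatibility of the coalgebra
structure with the unit holds automatically.) -/
@[ext]
structure CrossedSystem where
  /-- The weak action `h ▹ a`. -/
  act : H →ₗ[k] A →ₗ[k] A
  /-- The cocycle `f`. -/
  cocycle : H ⊗[k] H →ₗ[k] A
  act_one : ∀ h : H, act h 1 = counit (R := k) h • (1 : A)
  one_act : ∀ a : A, act 1 a = a
  /-- `h ▹ (ab) = (h₍₁₎ ▹ a)(h₍₂₎ ▹ b)`. -/
  act_mul : ∀ a b : A, act.flip (a * b) = convMap (act.flip a) (act.flip b)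
  crossed_assoc : ∀ u v w : A ⊗[k] H,
    crossedMul act cocycle (crossedMul act cocycle u v) w =
      crossedMul act cocycle u (crossedMul act cocycle v w)
  one_crossed : ∀ u : A ⊗[k] H, crossedMul act cocycle (1 ⊗ₜ[k] 1) u = u
  crossed_one : ∀ u : A ⊗[k] H, crossedMul act cocycle u (1 ⊗ₜ[k] 1) = u
  counit_crossed : ∀ u v : A ⊗[k] H,
    counit (R := k) (crossedMul act cocycle u v) = counit (R := k) u * counit (R := k) v
  /-- `Δ(uv) = u₍₁₎ v₍₁₎ ⊗ u₍₂₎ v₍₂₎`. -/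
  comul_crossed : ∀ u v : A ⊗[k] H,
    comul (R := k) (crossedMul act cocycle u v) =
      TensorProduct.map₂ (crossedMul act cocycle) (crossedMul act cocycle)
        (comul (R := k) u) (comul (R := k) v)
  exists_antipode : ∃ σ : A ⊗[k] H →ₗ[k] A ⊗[k] H, ∀ u : A ⊗[k] H,
    TensorProduct.lift (crossedMul act cocycle) (σ.rTensor _ (comul (R := k) u)) =
        counit (R := k) u • (1 ⊗ₜ[k] 1) ∧
      TensorProduct.lift (crossedMul act cocycle) (σ.lTensor _ (comul (R := k) u)) =
        counit (R := k) u • (1 ⊗ₜ[k] 1)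

namespace CrossedSystem

/-- The crossed product of Hopf algebras `A # H` of a crossed system; its underlying space is
`A ⊗ H`. -/
def Product (_S : CrossedSystem k A H) : Type _ := A ⊗[k] H

variable (S : CrossedSystem k A H)

/-- The element `a # h`. -/
def tmul (a : A) (h : H) : S.Product := a ⊗ₜ[k] h

instance : Ring S.Product :=
  letI : AddCommGroup S.Product := inferInstanceAs (AddCommGroup (A ⊗[k] H))
  { (inferInstance : AddCommGroup S.Product) with
    mul := fun u v => crossedMul S.act S.cocycle u v
    one := S.tmul 1 1
    mul_assoc := S.crossed_assoc
    one_mul := S.one_crossed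
    mul_one := S.crossed_one
    left_distrib := fun u v w => map_add (crossedMul S.act S.cocycle u) v w
    right_distrib := fun u v w => LinearMap.map_add₂ (crossedMul S.act S.cocycle) u v w
    zero_mul := fun u => LinearMap.map_zero₂ (crossedMul S.act S.cocycle) u
    mul_zero := fun u => map_zero (crossedMul S.act S.cocycle u) }

theorem mul_def (u v : S.Product) : u * v = crossedMul S.act S.cocycle u v := rfl

theorem one_def : (1 : S.Product) = S.tmul 1 1 := rfl

instance : Algebra k S.Product :=
  letI : Module k S.Product := inferInstanceAs (Module k (A ⊗[k] H))
  Algebra.ofModule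
    (fun r u v => LinearMap.map_smul₂ (crossedMul S.act S.cocycle) r u v)
    (fun r u v => map_smul (crossedMul S.act S.cocycle u) r v)

instance : Coalgebra k S.Product := inferInstanceAs (Coalgebra k (A ⊗[k] H))

theorem map₂_crossedMul (X Y : S.Product ⊗[k] S.Product) :
    (TensorProduct.map₂ (crossedMul S.act S.cocycle) (crossedMul S.act S.cocycle) X Y :
      (A ⊗[k] H) ⊗[k] (A ⊗[k] H)) = (X * Y : S.Product ⊗[k] S.Product) := by
  induction X with
  | zero => rw [zero_mul]; exact LinearMap.map_zero₂ _ _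
  | add X X' hX hX' =>
    rw [add_mul, ← hX, ← hX']; exact LinearMap.map_add₂ _ _ _ _
  | tmul a b =>
    induction Y with
    | zero => rw [mul_zero]; exact map_zero _
    | add Y Y' hY hY' => rw [mul_add, ← hY, ← hY']; exact map_add _ _ _
    | tmul c d =>
      have h := Algebra.TensorProduct.tmul_mul_tmul (R := k) (A := S.Product) (B := S.Product)
        a c b d
      exact h.symm

instance : Bialgebra k S.Product :=
  Bialgebra.mk' k S.Product
    (by
      change counit (R := k) ((1 : A) ⊗ₜ[k] (1 : H)) = 1
      simp)
    (fun {u v} => S.counit_crossed u v)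
    (by
      change comul (R := k) ((1 : A) ⊗ₜ[k] (1 : H)) =
        ((1 : A) ⊗ₜ[k] (1 : H)) ⊗ₜ[k] ((1 : A) ⊗ₜ[k] (1 : H))
      simp [TensorProduct.comul_tmul, Algebra.TensorProduct.one_def])
    (fun {u v} => (S.comul_crossed u v).trans (S.map₂_crossedMul _ _))

instance : HopfAlgebra k S.Product where
  antipode := (Classical.choose S.exists_antipode : A ⊗[k] H →ₗ[k] A ⊗[k] H)
  mul_antipode_rTensor_comul := by
    refine LinearMap.ext fun u => ?_
    refine Eq.trans ?_ (((Classical.choose_spec S.exists_antipode u).1).trans ?_)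
    · rfl
    · exact (Algebra.algebraMap_eq_smul_one (A := S.Product) _).symm
  mul_antipode_lTensor_comul := by
    refine LinearMap.ext fun u => ?_
    refine Eq.trans ?_ (((Classical.choose_spec S.exists_antipode u).2).trans ?_)
    · rfl
    · exact (Algebra.algebraMap_eq_smul_one (A := S.Product) _).symm

variable (k A H) in
/-- Two crossed systems are identified when their crossed products are isomorphic as Hopf
algebras. -/
def isoSetoid : Setoid (CrossedSystem k A H) where
  r S T := Nonempty (S.Product ≃ₐc[k] T.Product)
  iseqv :=
    ⟨fun S => ⟨BialgEquiv.refl k S.Product⟩, fun ⟨e⟩ => ⟨e.symm⟩, fun ⟨e⟩ ⟨e'⟩ => ⟨e.trans e'⟩⟩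

end CrossedSystem

variable (k A H) in
/-- `Crp (H, A)`: the set of Hopf algebra isomorphism types of all crossed products `A # H`. -/
def Crp : Type _ := Quotient (CrossedSystem.isoSetoid k A H)

/-- Cocentral maps: coalgebra maps with `r(h₍₁₎) ⊗ h₍₂₎ = r(h₍₂₎) ⊗ h₍₁₎`. -/
def IsCocentral (r : H →ₗc[k] A) : Prop :=
  ∀ h : H, (r : H →ₗ[k] A).rTensor H (comul (R := k) h) =
    (r : H →ₗ[k] A).rTensor H (TensorProduct.comm k H H (comul (R := k) h))

/-- Crossed systems `(▹, f)` and `(▹', f')` are cohomologous if there is a unitary cocentral map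
`r : H → A` such that
`h ▹' a = r(h₍₁₎) (h₍₂₎ ▹ a) S(r(h₍₃₎))` and
`f'(h, g) = r(h₍₁₎) (h₍₂₎ ▹ r(g₍₁₎)) f(h₍₃₎, g₍₂₎) S(r(h₍₄₎ g₍₃₎))`. -/
def CrossedSystem.Cohomologous (S T : CrossedSystem k A H) : Prop :=
  ∃ r : H →ₗc[k] A, IsCocentral r ∧ r 1 = 1 ∧
    (∀ a : A, T.act.flip a =
      convMap (convMap (r : H →ₗ[k] A) (S.act.flip a))
        (HopfAlgebra.antipode k ∘ₗ (r : H →ₗ[k] A))) ∧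
    T.cocycle =
      convMap (convMap (convMap (extendByCounit (r : H →ₗ[k] A))
        (TensorProduct.lift (S.act.compl₂ (r : H →ₗ[k] A)))) S.cocycle)
        (HopfAlgebra.antipode k ∘ₗ (r : H →ₗ[k] A) ∘ₗ LinearMap.mul' k H)

variable (k A H) in
/-- `ℋ² (H, A)`: crossed systems modulo being cohomologous. -/
def CohomH2 : Type _ := Quot (CrossedSystem.Cohomologous (k := k) (A := A) (H := H))

end Crossed

/-! ### Antipodes on noncommutative algebras -/

section Antipode

variable {k B : Type*} [Field k] [Ring B] [Bialgebra k B]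

/-- The left antipode identity at `b`. -/
def LeftAntipodeAt (σ : B →ₗ[k] B) (b : B) : Prop :=
  LinearMap.mul' k B (σ.rTensor B (comul (R := k) b)) = algebraMap k B (counit (R := k) b)

/-- The right antipode identity at `b`. -/
def RightAntipodeAt (σ : B →ₗ[k] B) (b : B) : Prop :=
  LinearMap.mul' k B (σ.lTensor B (comul (R := k) b)) = algebraMap k B (counit (R := k) b)

theorem leftAntipodeAt_mul {σ : B →ₗ[k] B} (hσ : ∀ a b, σ (a * b) = σ b * σ a) {a b : B}
    (ha : LeftAntipodeAt σ a) (hb : LeftAntipodeAt σ b) : LeftAntipodeAt σ (a * b) := by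
  have key : ∀ X Y : B ⊗[k] B, LinearMap.mul' k B (σ.rTensor B (X * Y)) =
      LinearMap.mul' k B (TensorProduct.map σ (LinearMap.mulLeft k
        (LinearMap.mul' k B (σ.rTensor B X))) Y) := by
    intro X Y
    induction Y with
    | zero => simp
    | add Y Y' h h' => simp only [mul_add, map_add, h, h']
    | tmul c d =>
      induction X with
      | zero => simp
      | add X X' h h' =>
        rw [add_mul, map_add, map_add, h, h']
        simp [add_mul, mul_add]
      | tmul e f => simp [hσ, mul_assoc]
  unfold LeftAntipodeAt at *
  rw [Bialgebra.comul_mul, key, ha, Bialgebra.counit_mul, map_mul, ← hb]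
  generalize comul (R := k) b = Y
  induction Y with
  | zero => simp
  | add Y Y' h h' => simp only [mul_add, map_add, h, h']
  | tmul c d => simp [Algebra.algebraMap_eq_smul_one]

theorem rightAntipodeAt_mul {σ : B →ₗ[k] B} (hσ : ∀ a b, σ (a * b) = σ b * σ a) {a b : B}
    (ha : RightAntipodeAt σ a) (hb : RightAntipodeAt σ b) : RightAntipodeAt σ (a * b) := by
  have key : ∀ X Y : B ⊗[k] B, LinearMap.mul' k B (σ.lTensor B (X * Y)) =
      LinearMap.mul' k B (TensorProduct.map (LinearMap.mulRight k
        (LinearMap.mul' k B (σ.lTensor B Y))) σ X) := by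
    intro X Y
    induction X with
    | zero => simp
    | add X X' h h' => simp only [add_mul, map_add, h, h']
    | tmul c d =>
      induction Y with
      | zero => simp
      | add X X' h h' =>
        rw [mul_add, map_add, map_add, h, h']
        simp [add_mul, mul_add]
      | tmul e f => simp [hσ, mul_assoc]
  unfold RightAntipodeAt at *
  rw [Bialgebra.comul_mul, key, hb, Bialgebra.counit_mul, mul_comm, map_mul, ← ha]
  generalize comul (R := k) a = Y
  induction Y with
  | zero => simp
  | add Y Y' h h' => simp only [mul_add, map_add, h, h']
  | tmul c d => simp [Algebra.algebraMap_eq_smul_one]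

/-- An anti-multiplicative unital linear map that satisfies the antipode identities on a set of
algebra generators makes a bialgebra a Hopf algebra. -/
@[reducible]
def HopfAlgebra.ofGenerators (σ : B →ₐ[k] Bᵐᵒᵖ) (s : Set B) (hs : Algebra.adjoin k s = ⊤)
    (hl : ∀ b ∈ s, LeftAntipodeAt ((MulOpposite.opLinearEquiv k).symm.toLinearMap ∘ₗ
      σ.toLinearMap) b)
    (hr : ∀ b ∈ s, RightAntipodeAt ((MulOpposite.opLinearEquiv k).symm.toLinearMap ∘ₗ
      σ.toLinearMap) b) : HopfAlgebra k B :=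
  have hσ : ∀ a b, ((MulOpposite.opLinearEquiv k).symm.toLinearMap ∘ₗ σ.toLinearMap) (a * b) =
      ((MulOpposite.opLinearEquiv k).symm.toLinearMap ∘ₗ σ.toLinearMap) b *
      ((MulOpposite.opLinearEquiv k).symm.toLinearMap ∘ₗ σ.toLinearMap) a := by
    intro a b; simp
  { antipode := (MulOpposite.opLinearEquiv k).symm.toLinearMap ∘ₗ σ.toLinearMap
    mul_antipode_rTensor_comul := by
      refine LinearMap.ext fun b => ?_
      have hb : b ∈ Algebra.adjoin k s := hs ▸ Algebra.mem_top
      induction hb using Algebra.adjoin_induction with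
      | mem b hb => exact hl b hb
      | algebraMap r => simp [Algebra.algebraMap_eq_smul_one, Algebra.TensorProduct.one_def]
      | add b c _ _ h h' => rw [map_add, map_add, h, h']
      | mul b c _ _ h h' => exact leftAntipodeAt_mul hσ h h'
    mul_antipode_lTensor_comul := by
      refine LinearMap.ext fun b => ?_
      have hb : b ∈ Algebra.adjoin k s := hs ▸ Algebra.mem_top
      induction hb using Algebra.adjoin_induction with
      | mem b hb => exact hr b hb
      | algebraMap r => simp [Algebra.algebraMap_eq_smul_one, Algebra.TensorProduct.one_def]
      | add b c _ _ h h' => rw [map_add, map_add, h, h']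
      | mul b c _ _ h h' => exact rightAntipodeAt_mul hσ h h' }

end Antipode

/-! ### The polynomial Hopf algebra `k[Y]` -/

namespace Polynomial

variable (k : Type*) [Field k]

/-- The bialgebra structure on `k[Y]` with `Y` primitive. -/
instance primitiveBialgebra : Bialgebra k k[X] :=
  Bialgebra.ofAlgHom
    (aeval ((X : k[X]) ⊗ₜ[k] (1 : k[X]) + (1 : k[X]) ⊗ₜ[k] (X : k[X])))
    (aeval 0)
    (by
      ext
      simp [Algebra.TensorProduct.one_def, TensorProduct.add_tmul, TensorProduct.tmul_add]
      abel)
    (by ext; simp)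
    (by ext; simp)

variable {k}

@[simp] theorem comul_X :
    comul (R := k) (X : k[X]) = (X : k[X]) ⊗ₜ[k] (1 : k[X]) + (1 : k[X]) ⊗ₜ[k] (X : k[X]) :=
  aeval_X _

@[simp] theorem counit_X : counit (R := k) (X : k[X]) = 0 := aeval_X _

variable (k)

instance primitiveHopfAlgebra : HopfAlgebra k k[X] :=
  HopfAlgebra.ofGenerators (aeval (MulOpposite.op (-X))) {X} adjoin_X
    (by rintro b rfl; simp [LeftAntipodeAt])
    (by rintro b rfl; simp [RightAntipodeAt])

end Polynomial

/-! ### Sweedler's four-dimensional Hopf algebra -/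

/-- Sweedler's Hopf algebra `H₄`, as an algebra: in `ℍ[k, 1, 0, 0]` the elements
`1, i, j, i j` form a basis and `i² = 1`, `j² = 0`, `j i = - i j`; put `g = i`, `x = j`. -/
abbrev Sweedler (k : Type*) [Field k] : Type _ := QuaternionAlgebra k 1 0 0

namespace Sweedler

variable (k : Type*) [Field k]

/-- The group-like generator `g` of `H₄`. -/
def g : Sweedler k := ⟨0, 1, 0, 0⟩

/-- The skew-primitive generator `x` of `H₄`. -/
def x : Sweedler k := ⟨0, 0, 1, 0⟩

theorem g_mul_g : g k * g k = 1 := by ext <;> simp [g]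

theorem x_mul_x : x k * x k = 0 := by ext <;> simp [x]

theorem x_mul_g : x k * g k = -(g k * x k) := by ext <;> simp [g, x]

/-- The pair of elements `G = g ⊗ g`, `X = x ⊗ 1 + g ⊗ x` satisfies the relations of `H₄`. -/
def comulBasis : QuaternionAlgebra.Basis (Sweedler k ⊗[k] Sweedler k) (1 : k) 0 0 where
  i := g k ⊗ₜ[k] g k
  j := x k ⊗ₜ[k] 1 + g k ⊗ₜ[k] x k
  k := (g k ⊗ₜ[k] g k) * (x k ⊗ₜ[k] 1 + g k ⊗ₜ[k] x k)
  i_mul_i := by simp [g_mul_g, Algebra.TensorProduct.one_def]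
  j_mul_j := by
    simp [mul_add, add_mul, g_mul_g, x_mul_x, x_mul_g, TensorProduct.neg_tmul]
  i_mul_j := rfl
  j_mul_i := by
    simp [mul_add, add_mul, g_mul_g, x_mul_g, TensorProduct.neg_tmul, TensorProduct.tmul_neg,
      add_comm]

/-- The pair `G = 1`, `X = 0` in `k` satisfies the relations of `H₄`. -/
def counitBasis : QuaternionAlgebra.Basis k (1 : k) 0 0 where
  i := 1
  j := 0
  k := 0
  i_mul_i := by simp
  j_mul_j := by simp
  i_mul_j := by simp
  j_mul_i := by simp

/-- The comultiplication: `g ↦ g ⊗ g`, `x ↦ x ⊗ 1 + g ⊗ x`. -/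
def comulHom : Sweedler k →ₐ[k] Sweedler k ⊗[k] Sweedler k := (comulBasis k).liftHom

/-- The counit: `g ↦ 1`, `x ↦ 0`. -/
def counitHom : Sweedler k →ₐ[k] k := (counitBasis k).liftHom

@[simp] theorem comulHom_g : comulHom k (g k) = g k ⊗ₜ[k] g k := by
  simp [comulHom, QuaternionAlgebra.Basis.liftHom, QuaternionAlgebra.Basis.lift, g, comulBasis]

@[simp] theorem comulHom_x : comulHom k (x k) = x k ⊗ₜ[k] 1 + g k ⊗ₜ[k] x k := by
  simp [comulHom, QuaternionAlgebra.Basis.liftHom, QuaternionAlgebra.Basis.lift, x, comulBasis]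

@[simp] theorem counitHom_g : counitHom k (g k) = 1 := by
  simp [counitHom, QuaternionAlgebra.Basis.liftHom, QuaternionAlgebra.Basis.lift, g, counitBasis]

@[simp] theorem counitHom_x : counitHom k (x k) = 0 := by
  simp [counitHom, QuaternionAlgebra.Basis.liftHom, QuaternionAlgebra.Basis.lift, x, counitBasis]

variable {k} in
theorem algHom_ext {B : Type*} [Ring B] [Algebra k B] {φ ψ : Sweedler k →ₐ[k] B}
    (hg : φ (g k) = ψ (g k)) (hx : φ (x k) = ψ (x k)) : φ = ψ :=
  QuaternionAlgebra.hom_ext hg hx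

instance : Bialgebra k (Sweedler k) :=
  Bialgebra.ofAlgHom (comulHom k) (counitHom k)
    (algHom_ext (by simp)
      (by simp [Algebra.TensorProduct.one_def, TensorProduct.add_tmul, TensorProduct.tmul_add,
        add_assoc]))
    (algHom_ext (by simp) (by simp))
    (algHom_ext (by simp) (by simp))

@[simp] theorem comul_g : comul (R := k) (g k) = g k ⊗ₜ[k] g k := comulHom_g k

@[simp] theorem comul_x : comul (R := k) (x k) = x k ⊗ₜ[k] 1 + g k ⊗ₜ[k] x k := comulHom_x k

@[simp] theorem counit_g : counit (R := k) (g k) = 1 := counitHom_g k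

@[simp] theorem counit_x : counit (R := k) (x k) = 0 := counitHom_x k

end Sweedler

namespace Sweedler

variable (k : Type*) [Field k]

/-- The pair `G = g`, `X = - g x` in the opposite algebra satisfies the relations of `H₄`. -/
def antipodeBasis : QuaternionAlgebra.Basis (Sweedler k)ᵐᵒᵖ (1 : k) 0 0 where
  i := MulOpposite.op (g k)
  j := MulOpposite.op (-(g k * x k))
  k := MulOpposite.op (-(g k * x k) * g k)
  i_mul_i := by simp [← MulOpposite.op_mul, g_mul_g]
  j_mul_j := by
    rw [← MulOpposite.op_mul]
    simp only [zero_smul]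
    rw [MulOpposite.op_eq_zero_iff]
    ext <;> simp [g, x]
  i_mul_j := rfl
  j_mul_i := by
    rw [← MulOpposite.op_mul, zero_smul, zero_sub, ← MulOpposite.op_neg]
    congr 1
    ext <;> simp [g, x]

/-- The antipode of `H₄`, as an algebra map to the opposite algebra: `g ↦ g`, `x ↦ - g x`. -/
def antipodeHom : Sweedler k →ₐ[k] (Sweedler k)ᵐᵒᵖ := (antipodeBasis k).liftHom

@[simp] theorem antipodeHom_g : antipodeHom k (g k) = MulOpposite.op (g k) := by
  simp [antipodeHom, QuaternionAlgebra.Basis.liftHom, QuaternionAlgebra.Basis.lift, g,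
    antipodeBasis]

@[simp] theorem antipodeHom_x : antipodeHom k (x k) = MulOpposite.op (-(g k * x k)) := by
  simp [antipodeHom, QuaternionAlgebra.Basis.liftHom, QuaternionAlgebra.Basis.lift, x,
    antipodeBasis]

theorem adjoin_g_x : Algebra.adjoin k {g k, x k} = ⊤ := by
  rw [eq_top_iff]
  intro q _
  have hg : g k ∈ Algebra.adjoin k {g k, x k} := Algebra.subset_adjoin (by simp)
  have hx : x k ∈ Algebra.adjoin k {g k, x k} := Algebra.subset_adjoin (by simp)
  have hq : q = algebraMap k _ q.re + q.imI • g k + q.imJ • x k + q.imK • (g k * x k) := by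
    ext <;> simp [g, x]
  rw [hq]
  exact add_mem (add_mem (add_mem (Subalgebra.algebraMap_mem _ _) (Subalgebra.smul_mem _ hg _))
    (Subalgebra.smul_mem _ hx _)) (Subalgebra.smul_mem _ (mul_mem hg hx) _)

instance : HopfAlgebra k (Sweedler k) :=
  HopfAlgebra.ofGenerators (antipodeHom k) {g k, x k} (adjoin_g_x k)
    (by
      rintro b (rfl | rfl)
      · simp [LeftAntipodeAt, g_mul_g]
      · simp [LeftAntipodeAt])
    (by
      rintro b (rfl | rfl)
      · simp [RightAntipodeAt, g_mul_g]
      · simp [RightAntipodeAt, ← mul_assoc, g_mul_g])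

end Sweedler

/-! ### The Hopf algebras `A_((αᵢ))` -/

/-- The names of the generators `Y`, `g`, `x`. -/
inductive QGen
  | Y
  | g
  | x

/-- The relations `g² = 1`, `x² = Σ αᵢ Y^{pⁱ}`, `x g = - g x`, `g Y = Y g`, `x Y = Y x` in the
free algebra on `Y, g, x`. -/
inductive QRel (k : Type*) [Field k] (p : ℕ) (α : ℕ →₀ k) :
    FreeAlgebra k QGen → FreeAlgebra k QGen → Prop
  | g_sq : QRel k p α (FreeAlgebra.ι k QGen.g * FreeAlgebra.ι k QGen.g) 1
  | x_sq : QRel k p α (FreeAlgebra.ι k QGen.x * FreeAlgebra.ι k QGen.x)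
      (α.sum fun i c => c • FreeAlgebra.ι k QGen.Y ^ p ^ i)
  | x_g : QRel k p α (FreeAlgebra.ι k QGen.x * FreeAlgebra.ι k QGen.g)
      (-(FreeAlgebra.ι k QGen.g * FreeAlgebra.ι k QGen.x))
  | g_Y : QRel k p α (FreeAlgebra.ι k QGen.g * FreeAlgebra.ι k QGen.Y)
      (FreeAlgebra.ι k QGen.Y * FreeAlgebra.ι k QGen.g)
  | x_Y : QRel k p α (FreeAlgebra.ι k QGen.x * FreeAlgebra.ι k QGen.Y)
      (FreeAlgebra.ι k QGen.Y * FreeAlgebra.ι k QGen.x)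

/-- The algebra `A_((αᵢ))` generated by `Y, g, x` subject to the relations `QRel`. -/
def QAlg (k : Type*) [Field k] (p : ℕ) (α : ℕ →₀ k) : Type _ := RingQuot (QRel k p α)

namespace QAlg

variable {k : Type*} [Field k] {p : ℕ} (α : ℕ →₀ k)

instance : Ring (QAlg k p α) := inferInstanceAs (Ring (RingQuot (QRel k p α)))

instance : Algebra k (QAlg k p α) := inferInstanceAs (Algebra k (RingQuot (QRel k p α)))

variable (k p) in
/-- The generators of `A_((αᵢ))`. -/
def gen (t : QGen) : QAlg k p α := RingQuot.mkAlgHom k (QRel k p α) (FreeAlgebra.ι k t)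

theorem g_sq : gen k p α .g * gen k p α .g = 1 := by
  simpa [gen] using! RingQuot.mkAlgHom_rel k (QRel.g_sq (k := k) (p := p) (α := α))

theorem x_sq : gen k p α .x * gen k p α .x = α.sum fun i c => c • gen k p α .Y ^ p ^ i := by
  simpa [gen, Finsupp.sum] using! RingQuot.mkAlgHom_rel k (QRel.x_sq (k := k) (p := p) (α := α))

theorem x_g : gen k p α .x * gen k p α .g = -(gen k p α .g * gen k p α .x) := by
  simpa [gen] using! RingQuot.mkAlgHom_rel k (QRel.x_g (k := k) (p := p) (α := α))

theorem g_Y : gen k p α .g * gen k p α .Y = gen k p α .Y * gen k p α .g := by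
  simpa [gen] using! RingQuot.mkAlgHom_rel k (QRel.g_Y (k := k) (p := p) (α := α))

theorem x_Y : gen k p α .x * gen k p α .Y = gen k p α .Y * gen k p α .x := by
  simpa [gen] using! RingQuot.mkAlgHom_rel k (QRel.x_Y (k := k) (p := p) (α := α))

/-- The universal property of `A_((αᵢ))`. -/
def lift {B : Type*} [Ring B] [Algebra k B] (v : QGen → B) (h1 : v .g * v .g = 1)
    (h2 : v .x * v .x = α.sum fun i c => c • v .Y ^ p ^ i) (h3 : v .x * v .g = -(v .g * v .x))
    (h4 : v .g * v .Y = v .Y * v .g) (h5 : v .x * v .Y = v .Y * v .x) : QAlg k p α →ₐ[k] B :=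
  RingQuot.liftAlgHom k ⟨FreeAlgebra.lift k v, by
    intro a b h
    cases h <;> simp [h1, h2, h3, h4, h5, Finsupp.sum]⟩

theorem lift_gen {B : Type*} [Ring B] [Algebra k B] (v : QGen → B) (h1 h2 h3 h4 h5) (t : QGen) :
    lift (k := k) (p := p) α v h1 h2 h3 h4 h5 (gen k p α t) = v t := by
  refine (RingQuot.liftAlgHom_mkAlgHom_apply k _ _ _).trans ?_
  simp

theorem algHom_ext {B : Type*} [Ring B] [Algebra k B] {φ ψ : QAlg k p α →ₐ[k] B}
    (h : ∀ t, φ (gen k p α t) = ψ (gen k p α t)) : φ = ψ :=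
  RingQuot.ringQuot_ext' _ _ _ (FreeAlgebra.hom_ext (funext h))

theorem adjoin_gen : Algebra.adjoin k (Set.range (gen k p α)) = ⊤ := by
  have h := (AlgHom.range_eq_top (RingQuot.mkAlgHom k (QRel k p α))).2
    (RingQuot.mkAlgHom_surjective k _)
  rw [← Algebra.map_top, ← FreeAlgebra.adjoin_range_ι, AlgHom.map_adjoin, ← Set.range_comp] at h
  exact h

variable [Fact p.Prime] [CharP k p]

/-- Additivity of `Σ αᵢ T^{pⁱ}` on commuting elements in characteristic `p`. -/
theorem sum_add {B : Type*} [Ring B] [Algebra k B] {a b : B} (h : Commute a b) :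
    (α.sum fun i c => c • (a + b) ^ p ^ i) =
      (α.sum fun i c => c • a ^ p ^ i) + α.sum fun i c => c • b ^ p ^ i := by
  have hp : (p : B) = 0 := by
    rw [← map_natCast (algebraMap k B), CharP.cast_eq_zero, map_zero]
  rw [← Finsupp.sum_add]
  refine Finsupp.sum_congr fun i _ => ?_
  obtain ⟨r, hr⟩ := h.exists_add_pow_prime_pow_eq (Fact.out : p.Prime) i
  rw [hr, hp]
  simp

/-- The comultiplication: `Y ↦ Y ⊗ 1 + 1 ⊗ Y`, `g ↦ g ⊗ g`, `x ↦ x ⊗ 1 + g ⊗ x`. -/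
def comulGen : QGen → QAlg k p α ⊗[k] QAlg k p α
  | .Y => gen k p α .Y ⊗ₜ[k] 1 + 1 ⊗ₜ[k] gen k p α .Y
  | .g => gen k p α .g ⊗ₜ[k] gen k p α .g
  | .x => gen k p α .x ⊗ₜ[k] 1 + gen k p α .g ⊗ₜ[k] gen k p α .x

/-- The counit: `Y ↦ 0`, `g ↦ 1`, `x ↦ 0`. -/
def counitGen (k : Type*) [Field k] : QGen → k
  | .Y => 0
  | .g => 1
  | .x => 0

/-- The antipode: `Y ↦ - Y`, `g ↦ g`, `x ↦ - g x`. -/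
def antipodeGen : QGen → (QAlg k p α)ᵐᵒᵖ
  | .Y => MulOpposite.op (-gen k p α .Y)
  | .g => MulOpposite.op (gen k p α .g)
  | .x => MulOpposite.op (-(gen k p α .g * gen k p α .x))

/-- The comultiplication as an algebra map. -/
def comulHom : QAlg k p α →ₐ[k] QAlg k p α ⊗[k] QAlg k p α :=
  lift α (comulGen α)
    (by simp [comulGen, g_sq, Algebra.TensorProduct.one_def])
    (by
      have hc : Commute (gen k p α .Y ⊗ₜ[k] (1 : QAlg k p α))
          ((1 : QAlg k p α) ⊗ₜ[k] gen k p α .Y) := by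
        simp [Commute, SemiconjBy]
      have h1 : ∀ n : ℕ, (gen k p α .Y ⊗ₜ[k] (1 : QAlg k p α)) ^ n =
          (gen k p α .Y ^ n) ⊗ₜ[k] (1 : QAlg k p α) := by
        intro n; simp [Algebra.TensorProduct.tmul_pow]
      have h2 : ∀ n : ℕ, ((1 : QAlg k p α) ⊗ₜ[k] gen k p α .Y) ^ n =
          (1 : QAlg k p α) ⊗ₜ[k] (gen k p α .Y ^ n) := by
        intro n; simp [Algebra.TensorProduct.tmul_pow]
      simp only [comulGen, sum_add α hc, h1, h2, mul_add, add_mul,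
        Algebra.TensorProduct.tmul_mul_tmul, mul_one, one_mul, g_sq, x_sq, x_g]
      simp [Finsupp.sum, TensorProduct.sum_tmul, TensorProduct.tmul_sum, TensorProduct.neg_tmul,
        TensorProduct.smul_tmul'])
    (by
      simp [comulGen, mul_add, add_mul, g_sq, x_g, TensorProduct.neg_tmul, TensorProduct.tmul_neg,
        add_comm])
    (by simp [comulGen, mul_add, add_mul, g_Y])
    (by simp [comulGen, mul_add, add_mul, g_Y, x_Y]; abel)

/-- The counit as an algebra map. -/
def counitHom : QAlg k p α →ₐ[k] k :=
  lift α (counitGen k) (by simp [counitGen])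
    (by
      simp [counitGen, (Fact.out : p.Prime).ne_zero, Finsupp.sum])
    (by simp [counitGen]) (by simp [counitGen]) (by simp [counitGen])

theorem comulHom_gen (t : QGen) : comulHom α (gen k p α t) = comulGen α t := lift_gen ..

theorem counitHom_gen (t : QGen) : counitHom α (gen k p α t) = counitGen k t := lift_gen ..

instance : Bialgebra k (QAlg k p α) :=
  Bialgebra.ofAlgHom (comulHom α) (counitHom α)
    (algHom_ext α (by
      rintro (_ | _ | _) <;>
      simp [comulHom_gen, comulGen, Algebra.TensorProduct.one_def, TensorProduct.add_tmul,
        TensorProduct.tmul_add, add_assoc]))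
    (algHom_ext α (by
      rintro (_ | _ | _) <;>
      simp [comulHom_gen, comulGen, counitHom_gen, counitGen]))
    (algHom_ext α (by
      rintro (_ | _ | _) <;>
      simp [comulHom_gen, comulGen, counitHom_gen, counitGen]))

theorem comul_Y : comul (R := k) (gen k p α .Y) =
    gen k p α .Y ⊗ₜ[k] 1 + 1 ⊗ₜ[k] gen k p α .Y := comulHom_gen α .Y

theorem comul_g : comul (R := k) (gen k p α .g) = gen k p α .g ⊗ₜ[k] gen k p α .g :=
  comulHom_gen α .g

theorem comul_x : comul (R := k) (gen k p α .x) =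
    gen k p α .x ⊗ₜ[k] 1 + gen k p α .g ⊗ₜ[k] gen k p α .x := comulHom_gen α .x

theorem counit_gen (t : QGen) : counit (R := k) (gen k p α t) = counitGen k t :=
  counitHom_gen α t

/-- The antipode as an algebra map to the opposite algebra. -/
def antipodeHom : QAlg k p α →ₐ[k] (QAlg k p α)ᵐᵒᵖ :=
  lift α (antipodeGen α)
    (by simp [antipodeGen, ← MulOpposite.op_mul, g_sq])
    (by
      have h0 : (α.sum fun i c => c • (-gen k p α .Y) ^ p ^ i) =
          -α.sum fun i c => c • gen k p α .Y ^ p ^ i := by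
        have h := sum_add α (a := -gen k p α .Y) (b := gen k p α .Y)
          (Commute.neg_left (Commute.refl _))
        have hz : (α.sum fun i c => c • (0 : QAlg k p α) ^ p ^ i) = 0 := by
          simp [(Fact.out : p.Prime).ne_zero, Finsupp.sum]
        rw [neg_add_cancel, hz] at h
        exact eq_neg_of_add_eq_zero_left h.symm
      have h1 : (α.sum fun i c => c • (MulOpposite.op (-gen k p α .Y)) ^ p ^ i) =
          MulOpposite.op (α.sum fun i c => c • (-gen k p α .Y) ^ p ^ i) := by
        simp [Finsupp.sum]
      have h2 : gen k p α .g * gen k p α .x * (gen k p α .g * gen k p α .x) =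
          -(gen k p α .x * gen k p α .x) := by
        rw [mul_assoc, ← mul_assoc (gen k p α .x), x_g, neg_mul, mul_neg, mul_assoc,
          ← mul_assoc, g_sq, one_mul]
      simp only [antipodeGen]
      rw [h1, h0, ← MulOpposite.op_mul, neg_mul_neg, h2, x_sq])
    (by
      have h1 : gen k p α .g * gen k p α .x * gen k p α .g = -gen k p α .x := by
        rw [mul_assoc, x_g, mul_neg, ← mul_assoc, g_sq, one_mul]
      simp only [antipodeGen, ← MulOpposite.op_mul, ← MulOpposite.op_neg]
      rw [mul_neg, ← mul_assoc, g_sq, one_mul, neg_mul, h1, neg_neg])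
    (by simp [antipodeGen, ← MulOpposite.op_mul, g_Y])
    (by
      simp only [antipodeGen, ← MulOpposite.op_mul]
      rw [neg_mul_neg, neg_mul_neg, mul_assoc, x_Y, ← mul_assoc, ← mul_assoc, g_Y])

theorem antipodeHom_gen (t : QGen) : antipodeHom α (gen k p α t) = antipodeGen α t :=
  lift_gen ..

instance : HopfAlgebra k (QAlg k p α) :=
  HopfAlgebra.ofGenerators (antipodeHom α) (Set.range (gen k p α)) (adjoin_gen α)
    (by
      rintro _ ⟨_ | _ | _, rfl⟩ <;>
      simp [LeftAntipodeAt, comul_Y, comul_g, comul_x, counit_gen, counitGen, antipodeHom_gen,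
        antipodeGen, g_sq])
    (by
      rintro _ ⟨_ | _ | _, rfl⟩ <;>
      simp [RightAntipodeAt, comul_Y, comul_g, comul_x, counit_gen, counitGen, antipodeHom_gen,
        antipodeGen, g_sq, ← mul_assoc])

end QAlg

/-! ### The group `G((αᵢ))` and the relation `∼` -/

section Sequences

variable {k : Type*} [Field k] (p : ℕ)

/-- `G((αᵢ)) = {(a, b) ∈ kˣ × kˣ | a^{pⁱ} = b² for all i with αᵢ ≠ 0}`. -/
def seqGroup (α : ℕ →₀ k) : Subgroup (kˣ × kˣ) where
  carrier := {q | ∀ i, α i ≠ 0 → q.1 ^ p ^ i = q.2 ^ 2}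
  mul_mem' := by
    intro q r hq hr i hi
    simp [mul_pow, hq i hi, hr i hi]
  one_mem' := by simp
  inv_mem' := by
    intro q hq i hi
    simp [hq i hi]

variable (k) in
/-- `(αᵢ) ∼ (βᵢ)` if there are `a, b ∈ kˣ` with `a^{pⁱ} αᵢ = b² βᵢ` for all `i`. -/
def seqSetoid : Setoid (ℕ →₀ k) where
  r α β := ∃ a b : kˣ, ∀ i, (a : k) ^ p ^ i * α i = (b : k) ^ 2 * β i
  iseqv := by
    refine ⟨fun α => ⟨1, 1, by simp⟩, ?_, ?_⟩
    · rintro α β ⟨a, b, h⟩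
      refine ⟨a⁻¹, b⁻¹, fun i => ?_⟩
      have ha : (a : k) ≠ 0 := a.ne_zero
      have hb : (b : k) ≠ 0 := b.ne_zero
      have := h i
      simp only [Units.val_inv_eq_inv_val, inv_pow]
      field_simp
      rw [mul_comm, ← this, mul_comm]
    · rintro α β γ ⟨a, b, h⟩ ⟨c, d, h'⟩
      refine ⟨a * c, b * d, fun i => ?_⟩
      have h1 := h i
      have h2 := h' i
      push_cast
      calc ((a : k) * c) ^ p ^ i * α i = (c : k) ^ p ^ i * ((a : k) ^ p ^ i * α i) := by ring
        _ = (b : k) ^ 2 * ((c : k) ^ p ^ i * β i) := by rw [h1]; ring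
        _ = ((b : k) * d) ^ 2 * γ i := by rw [h2]; ring

end Sequences

end

noncomputable section

/-! ### Primitive and group-like elements of `k[Y]` -/

namespace Polynomial

variable {k : Type*} [Field k]

/-! The coalgebra structure of a crossed product is fixed, and it leaves the multiplication almost
no freedom. Write `Y`, `g`, `x` for `Y # 1`, `1 # g`, `1 # x`. The product formula gives `g²`, `gY`,
`xY`, `gx`, `xg` up to correction terms `t # 1`; since `Δ` is multiplicative, `f(g, g)` is
group-like in `k[Y]`, hence `1`, and the other corrections satisfy equations such as `Δ(t) = t ⊗ 1 +
g ⊗ t`, which force them to vanish or to be trivial. So the action is trivial and the only free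
datum is `f(x, x) = x²`. It is primitive, hence an additive polynomial `Σ αᵢ Y^{pⁱ}` in
characteristic `p` (`exists_eq_sum_of_primitive`), and it determines the whole multiplication
(`crossedMul_eq`).

Conversely, every additive polynomial occurs. A map to a quaternion algebra over `k[Y]` shows that
the monomials `Yⁿ`, `Yⁿg`, `Yⁿx`, `Yⁿgx` form a basis of `A_((αᵢ))`, and the Hopf structure is
carried back to `k[Y] ⊗ H₄` along it (`QAlg.crossedSystem`). Thus crossed systems correspond to
sequences (`crossedSystem_bijective`). A unitary cocentral map `H₄ → k[Y]` is trivial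
(`eq_of_isCocentral`), so being cohomologous is equality, which gives (3).

For isomorphisms one finds the group-like elements `1`, `g`, the primitive elements, all polynomials
in `Y`, and the skew-primitive elements `c(1 - g) + dx`. Hence an isomorphism fixes `g` and sends
`Y` to `aY` and `x` to `bx`; the term in `1 - g` is excluded by `xg = -gx` and `2 ≠ 0`. Applying it
to the relation for `x²` gives `a^{pⁱ} αᵢ = b² βᵢ` (`exists_eq_scaleEquiv`), from which the
automorphism groups and the classification in (2) follow. -/

theorem comul_X_pow (n : ℕ) : comul (R := k) ((X : k[X]) ^ n) =
    ∑ m ∈ Finset.range (n + 1), (n.choose m : k) •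
      (((X : k[X]) ^ m) ⊗ₜ[k] ((X : k[X]) ^ (n - m))) := by
  have hc : Commute ((X : k[X]) ⊗ₜ[k] (1 : k[X])) ((1 : k[X]) ⊗ₜ[k] (X : k[X])) :=
    Commute.all _ _
  rw [Bialgebra.comul_pow, comul_X, hc.add_pow]
  refine Finset.sum_congr rfl fun m _ => ?_
  rw [Algebra.TensorProduct.tmul_pow, Algebra.TensorProduct.tmul_pow, one_pow, one_pow,
    Algebra.TensorProduct.tmul_mul_tmul, one_mul, mul_one, mul_comm, ← nsmul_eq_mul,
    Nat.cast_smul_eq_nsmul]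

/-- Turns an equation for `Δ P` into scalar equations between coefficients; the binomial comes from
expanding `(Y ⊗ 1 + 1 ⊗ Y)^(i + j)`. -/
theorem map_lcoeff_comul (P : k[X]) (i j : ℕ) :
    TensorProduct.lid k k (TensorProduct.map (lcoeff k i) (lcoeff k j) (comul (R := k) P)) =
      ((i + j).choose i : k) * P.coeff (i + j) := by
  induction P using Polynomial.induction_on' with
  | add P Q hP hQ => simp only [map_add, hP, hQ, coeff_add, mul_add]
  | monomial n c =>
    rw [← C_mul_X_pow_eq_monomial, C_mul', map_smul, map_smul, map_smul, comul_X_pow, map_sum,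
      map_sum]
    simp only [map_smul, TensorProduct.map_tmul, lcoeff_apply, TensorProduct.lid_tmul, coeff_X_pow,
      smul_eq_mul, coeff_smul]
    by_cases h : i + j = n
    · subst h
      rw [Finset.sum_eq_single i]
      · simp [mul_comm]
      · intro m _ hm
        simp [hm.symm]
      · simp
    · rw [Finset.sum_eq_zero]
      · simp [h]
      · intro m hm
        have : m ≤ n := by simpa [Nat.lt_succ_iff] using hm
        by_cases h1 : i = m
        · have : j ≠ n - m := by omega
          simp [this]
        · simp [h1]

/-! ### Additive polynomials in characteristic `p`. -/

section Additive

variable (p : ℕ)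

theorem coeff_sum_X_pow_pow (hp : 1 < p) (α : ℕ →₀ k) (j : ℕ) :
    (α.sum fun i c => c • (X : k[X]) ^ p ^ i).coeff (p ^ j) = α j := by
  rw [Finsupp.sum, finsetSum_coeff]
  simp only [coeff_smul, coeff_X_pow, smul_eq_mul, Nat.pow_right_inj hp]
  simp

theorem coeff_sum_X_pow_of_ne (α : ℕ →₀ k) {n : ℕ} (hn : ∀ j, n ≠ p ^ j) :
    (α.sum fun i c => c • (X : k[X]) ^ p ^ i).coeff n = 0 := by
  rw [Finsupp.sum, finsetSum_coeff]
  simp [coeff_X_pow, hn]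

theorem sum_X_pow_pow_injective (hp : 1 < p) :
    Function.Injective fun α : ℕ →₀ k => α.sum fun i c => c • (X : k[X]) ^ p ^ i := by
  intro α β h
  ext j
  rw [← coeff_sum_X_pow_pow p hp α j, ← coeff_sum_X_pow_pow p hp β j]
  exact congrArg (fun P => coeff P (p ^ j)) h

/-- In characteristic `p` the primitive elements of `k[Y]` are the additive polynomials. -/
theorem exists_eq_sum_of_primitive [hp : Fact p.Prime] [CharP k p] {P : k[X]}
    (hP : comul (R := k) P = P ⊗ₜ[k] 1 + 1 ⊗ₜ[k] P) :
    ∃ α : ℕ →₀ k, P = α.sum fun i c => c • (X : k[X]) ^ p ^ i := by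
  have key : ∀ i j : ℕ, ((i + j).choose i : k) * P.coeff (i + j) =
      P.coeff i * (1 : k[X]).coeff j + (1 : k[X]).coeff i * P.coeff j := by
    intro i j
    rw [← map_lcoeff_comul, hP]
    simp
  have h0 : P.coeff 0 = 0 := by simpa using key 0 0
  have hz : ∀ n, (∀ j, n ≠ p ^ j) → P.coeff n = 0 := by
    intro n hn
    rcases eq_or_ne n 0 with rfl | hn0
    · exact h0
    obtain ⟨a, m, hm, rfl⟩ := Nat.exists_eq_pow_mul_and_not_dvd hn0 p hp.out.ne_one
    have hm1 : m ≠ 1 := fun h => hn a (by simp [h])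
    have hm0 : m ≠ 0 := fun h => hn0 (by simp [h])
    obtain ⟨l, rfl⟩ : ∃ l, m = 1 + (l + 1) := ⟨m - 2, by omega⟩
    have hpa : p ^ a ≠ 0 := pow_ne_zero _ hp.out.ne_zero
    -- With `n = p^a m`, `p ∤ m` and `m ≥ 2`, compare coefficients at `Y^(p^a) ⊗ Y^(n - p^a)`. Both
    -- exponents are positive, so the right side is zero, while `(n choose p^a) ≡ m` is nonzero mod
    -- `p`.
    have h := key (p ^ a) (p ^ a * (l + 1))
    rw [coeff_one, coeff_one, if_neg (by positivity), if_neg hpa, mul_zero, zero_mul, add_zero,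
      show p ^ a + p ^ a * (l + 1) = p ^ a * (1 + (l + 1)) by ring] at h
    refine (mul_eq_zero.1 h).resolve_left fun hc => hm ?_
    rw [CharP.cast_eq_zero_iff k p] at hc
    have hmod := Choose.choose_pow_mul_pow_mul_modEq_choose_nat (p := p) (k := a)
      (a := 1 + (l + 1)) (b := 1)
    rw [mul_one, Nat.choose_one_right] at hmod
    exact (hmod.dvd_iff dvd_rfl).1 hc
  refine ⟨Finsupp.comapDomain (p ^ ·) P.toFinsupp.coeff
    (Nat.pow_right_injective hp.out.two_le).injOn, ?_⟩
  ext n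
  by_cases hn : ∃ j, n = p ^ j
  · obtain ⟨j, rfl⟩ := hn
    rw [coeff_sum_X_pow_pow p hp.out.one_lt]
    rfl
  · push Not at hn
    rw [hz n hn, coeff_sum_X_pow_of_ne p _ hn]

end Additive

/-- The counit axiom makes `ε ⊗ id` a left inverse of `Δ`. -/
theorem comul_injective : Function.Injective (comul (R := k) : k[X] → k[X] ⊗[k] k[X]) := by
  intro P Q h
  simpa using congrArg (TensorProduct.lid k k[X] ∘ (counit (R := k)).rTensor k[X]) h

theorem eq_C_of_comul_eq_tmul_one {P : k[X]} (h : comul (R := k) P = P ⊗ₜ[k] 1) :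
    P = C (counit (R := k) P) := by
  have := congrArg (TensorProduct.lid k k[X] ∘ (counit (R := k)).rTensor k[X]) h
  simpa [← C_mul'] using this

/-- The only group-like element of `k[Y]` is `1`. -/
theorem eq_one_of_isGroupLikeElem {P : k[X]} (h : IsGroupLikeElem k P) : P = 1 := by
  -- Group-like elements are invertible, and the units of `k[Y]` are constants; the counit then
  -- fixes the constant.
  obtain ⟨c, -, hc⟩ := Polynomial.isUnit_iff.1 h.isUnit
  have h1 := h.counit_eq_one
  rw [← hc] at h1 ⊢
  rw [← algebraMap_eq, Bialgebra.counit_algebraMap] at h1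
  rw [h1, C_1]

end Polynomial

/-! ### Linear maps on `H₄` and coordinates on `k[Y] ⊗ H₄` -/

namespace Sweedler

variable {k : Type*} [Field k]

theorem eq_sum (q : Sweedler k) :
    q = q.re • 1 + q.imI • g k + q.imJ • x k + q.imK • (g k * x k) := by
  ext <;> simp [g, x]

theorem linearMap_ext {M : Type*} [AddCommGroup M] [Module k M] {φ ψ : Sweedler k →ₗ[k] M}
    (h1 : φ 1 = ψ 1) (hg : φ (g k) = ψ (g k)) (hx : φ (x k) = ψ (x k))
    (hgx : φ (g k * x k) = ψ (g k * x k)) : φ = ψ := by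
  ext q
  rw [eq_sum q]
  simp only [map_add, map_smul, h1, hg, hx, hgx]

@[simp] theorem comul_g_mul_x : comul (R := k) (g k * x k) =
    (g k * x k) ⊗ₜ[k] g k + 1 ⊗ₜ[k] (g k * x k) := by
  simp [Bialgebra.comul_mul, mul_add, g_mul_g]

@[simp] theorem counit_g_mul_x : counit (R := k) (g k * x k) = 0 := by simp

/-- The four coordinates of an element of `H₄`. -/
def coord (k : Type*) [Field k] : Fin 4 → Sweedler k →ₗ[k] k :=
  ![QuaternionAlgebra.reₗ 1 0 0, QuaternionAlgebra.imIₗ 1 0 0, QuaternionAlgebra.imJₗ 1 0 0,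
    QuaternionAlgebra.imKₗ 1 0 0]

theorem coord_one (i : Fin 4) : coord k i 1 = if i = 0 then 1 else 0 := by
  fin_cases i <;> simp [coord]

theorem coord_g (i : Fin 4) : coord k i (g k) = if i = 1 then 1 else 0 := by
  fin_cases i <;> simp [coord, g]

theorem coord_x (i : Fin 4) : coord k i (x k) = if i = 2 then 1 else 0 := by
  fin_cases i <;> simp [coord, x]

theorem coord_g_mul_x (i : Fin 4) : coord k i (g k * x k) = if i = 3 then 1 else 0 := by
  fin_cases i <;> simp [coord, g, x]

variable (k) in
/-- The linear map on `A ⊗ H₄` that applies a coordinate to the second factor. -/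
def coeffMap (A : Type*) [AddCommGroup A] [Module k A] (i : Fin 4) : A ⊗[k] Sweedler k →ₗ[k] A :=
  (TensorProduct.rid k A).toLinearMap ∘ₗ (coord k i).lTensor A

@[simp] theorem coeffMap_tmul {A : Type*} [AddCommGroup A] [Module k A] (i : Fin 4) (a : A)
    (h : Sweedler k) : coeffMap k A i (a ⊗ₜ[k] h) = coord k i h • a := by
  simp [coeffMap]

theorem eq_sum_coeffMap {A : Type*} [AddCommGroup A] [Module k A] (z : A ⊗[k] Sweedler k) :
    z = coeffMap k A 0 z ⊗ₜ[k] 1 + coeffMap k A 1 z ⊗ₜ[k] g k + coeffMap k A 2 z ⊗ₜ[k] x k +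
      coeffMap k A 3 z ⊗ₜ[k] (g k * x k) := by
  induction z with
  | zero => simp
  | add z z' h h' =>
    conv_lhs => rw [h, h']
    simp only [map_add, TensorProduct.add_tmul]
    abel
  | tmul a h =>
    conv_lhs => rw [eq_sum h]
    simp [TensorProduct.tmul_add, TensorProduct.smul_tmul, coord]

/-- The coproduct of `A ⊗ H₄` only interchanges the middle factors of `Δ a ⊗ Δ h`, so coordinates on
the two `H₄` slots extract a scalar and leave `Δ a`. -/
theorem map_coeffMap_comul_tmul {A : Type*} [AddCommGroup A] [Module k A] [Coalgebra k A]
    (i j : Fin 4) (a : A) (h : Sweedler k) :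
    TensorProduct.map (coeffMap k A i) (coeffMap k A j) (comul (R := k) (a ⊗ₜ[k] h)) =
      TensorProduct.lid k k (TensorProduct.map (coord k i) (coord k j) (comul (R := k) h)) •
        comul (R := k) a := by
  rw [TensorProduct.comul_tmul]
  generalize comul (R := k) h = U
  generalize comul (R := k) a = V
  induction U with
  | zero => simp
  | add U U' h h' => simp only [TensorProduct.tmul_add, map_add, h, h', add_smul]
  | tmul b c =>
    induction V with
    | zero => simp
    | add V V' h h' => simp only [TensorProduct.add_tmul, map_add, h, h', smul_add]
    | tmul d e => simp [TensorProduct.smul_tmul', smul_smul, mul_comm]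

/-- The coordinates of the comultiplication of `A ⊗ H₄`. -/
theorem map_coeffMap_comul {A : Type*} [AddCommGroup A] [Module k A] [Coalgebra k A]
    (i j : Fin 4) (z : A ⊗[k] Sweedler k) :
    TensorProduct.map (coeffMap k A i) (coeffMap k A j) (comul (R := k) z) =
      if i = 0 ∧ j = 0 then comul (R := k) (coeffMap k A 0 z)
      else if i = 1 ∧ j = 1 then comul (R := k) (coeffMap k A 1 z)
      else if (i = 2 ∧ j = 0) ∨ (i = 1 ∧ j = 2) then comul (R := k) (coeffMap k A 2 z)
      else if (i = 3 ∧ j = 1) ∨ (i = 0 ∧ j = 3) then comul (R := k) (coeffMap k A 3 z)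
      else 0 := by
  -- The coproducts of `1`, `g`, `x`, `gx` have six terms in all, lying in six different index
  -- pairs, so no pair mixes two coordinates of `z`.
  conv_lhs => rw [eq_sum_coeffMap z]
  simp only [map_add, map_coeffMap_comul_tmul, Bialgebra.comul_one, comul_g, comul_x,
    comul_g_mul_x, Algebra.TensorProduct.one_def, TensorProduct.map_tmul, TensorProduct.lid_tmul,
    coord_one, coord_g, coord_x, coord_g_mul_x]
  fin_cases i <;> fin_cases j <;> simp

end Sweedler

/-! ### The monomials `Yⁿ`, `Yⁿ g`, `Yⁿ x`, `Yⁿ g x` -/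

section MonomialMap

open Polynomial

variable {k : Type*} [Field k] {B : Type*} [Ring B] [Algebra k B]

/-- The linear map `H₄ → B` with `1 ↦ 1`, `g ↦ g'`, `x ↦ x'`, `g x ↦ g' x'`. -/
def sweedlerMap (g' x' : B) : Sweedler k →ₗ[k] B :=
  (Sweedler.coord k 0).smulRight 1 + (Sweedler.coord k 1).smulRight g' +
    (Sweedler.coord k 2).smulRight x' + (Sweedler.coord k 3).smulRight (g' * x')

@[simp] theorem sweedlerMap_one (g' x' : B) : sweedlerMap (k := k) g' x' 1 = 1 := by
  simp [sweedlerMap, Sweedler.coord_one]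

@[simp] theorem sweedlerMap_g (g' x' : B) : sweedlerMap g' x' (Sweedler.g k) = g' := by
  simp [sweedlerMap, Sweedler.coord_g]

@[simp] theorem sweedlerMap_x (g' x' : B) : sweedlerMap g' x' (Sweedler.x k) = x' := by
  simp [sweedlerMap, Sweedler.coord_x]

@[simp] theorem sweedlerMap_g_mul_x (g' x' : B) :
    sweedlerMap g' x' (Sweedler.g k * Sweedler.x k) = g' * x' := by
  simp [sweedlerMap, Sweedler.coord_g_mul_x]

/-- The linear map `k[Y] ⊗ H₄ → B` with `P ⊗ h ↦ P(y) h'`, where `h'` is the image of `h` under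
`sweedlerMap`. -/
def monomialMap (y g' x' : B) : k[X] ⊗[k] Sweedler k →ₗ[k] B :=
  LinearMap.mul' k B ∘ₗ TensorProduct.map (aeval y).toLinearMap (sweedlerMap g' x')

@[simp] theorem monomialMap_tmul (y g' x' : B) (P : k[X]) (h : Sweedler k) :
    monomialMap y g' x' (P ⊗ₜ[k] h) = aeval y P * sweedlerMap g' x' h := by
  simp [monomialMap]

theorem map_sweedlerMap {C : Type*} [Ring C] [Algebra k C] (φ : B →ₐ[k] C) (g' x' : B)
    (h : Sweedler k) : φ (sweedlerMap g' x' h) = sweedlerMap (φ g') (φ x') h := by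
  simp [sweedlerMap]

theorem map_monomialMap {C : Type*} [Ring C] [Algebra k C] (φ : B →ₐ[k] C) (y g' x' : B)
    (z : k[X] ⊗[k] Sweedler k) :
    φ (monomialMap y g' x' z) = monomialMap (φ y) (φ g') (φ x') z := by
  induction z with
  | zero => simp
  | add z z' h h' => simp only [map_add, h, h']
  | tmul P h => simp [map_sweedlerMap, aeval_algHom_apply]

theorem commute_sweedlerMap {a g' x' : B} (hg : Commute a g') (hx : Commute a x')
    (h : Sweedler k) : Commute a (sweedlerMap g' x' h) := by
  simp only [sweedlerMap, LinearMap.add_apply, LinearMap.smulRight_apply]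
  exact ((((Commute.one_right a).smul_right _).add_right (hg.smul_right _)).add_right
    (hx.smul_right _)).add_right ((hg.mul_right hx).smul_right _)

theorem commute_aeval {y b : B} (h : Commute y b) (P : k[X]) : Commute (aeval y P) b := by
  induction P using Polynomial.induction_on' with
  | add P Q hP hQ => rw [map_add]; exact hP.add_left hQ
  | monomial n c =>
    rw [aeval_monomial]
    exact (Algebra.commute_algebraMap_left c b).mul_left (h.pow_left n)

end MonomialMap

/-! ### The crossed product with trivial action and cocycle determined by `f(x, x) = q` -/

section TrivialAction

open Polynomial

variable {k : Type*} [Field k]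

/-- The trivial action `h ▹ a = ε(h) a`. -/
def trivialAct (k : Type*) [Field k] (A H : Type*) [AddCommGroup A] [Module k A]
    [AddCommGroup H] [Module k H] [Coalgebra k H] : H →ₗ[k] A →ₗ[k] A :=
  (counit (R := k) (A := H)).smulRight LinearMap.id

@[simp] theorem trivialAct_apply {A H : Type*} [AddCommGroup A] [Module k A]
    [AddCommGroup H] [Module k H] [Coalgebra k H] (h : H) (a : A) :
    trivialAct k A H h a = counit (R := k) h • a := rfl

/-- The linear map `f : H₄ ⊗ H₄ → k[Y]` with `f(x, x) = f(g x, x) = q`,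
`f(x, g x) = f(g x, g x) = -q` and `f(h, h') = ε(h) ε(h')` on the other pairs of basis elements. -/
def sweedlerCocycle (q : k[X]) : Sweedler k ⊗[k] Sweedler k →ₗ[k] k[X] :=
  (counit (R := k)).smulRight 1 +
    ((TensorProduct.lid k k).toLinearMap ∘ₗ TensorProduct.map
      (Sweedler.coord k 2 + Sweedler.coord k 3)
      (Sweedler.coord k 2 - Sweedler.coord k 3)).smulRight q

@[simp] theorem sweedlerCocycle_tmul (q : k[X]) (h h' : Sweedler k) :
    sweedlerCocycle q (h ⊗ₜ[k] h') = (counit (R := k) h * counit (R := k) h') • (1 : k[X]) +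
      ((Sweedler.coord k 2 h + Sweedler.coord k 3 h) *
        (Sweedler.coord k 2 h' - Sweedler.coord k 3 h')) • q := by
  simp [sweedlerCocycle, mul_comm (counit (R := k) h)]

theorem crossedMul_tmul_left {A H : Type*} [Ring A] [HopfAlgebra k A] [Ring H] [HopfAlgebra k H]
    (act : H →ₗ[k] A →ₗ[k] A) (f : H ⊗[k] H →ₗ[k] A) (a : A) (h : H) (v : A ⊗[k] H) :
    crossedMul act f (a ⊗ₜ[k] h) v =
      (LinearMap.mulLeft k a).rTensor H (crossedMul act f (1 ⊗ₜ[k] h) v) := by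
  induction v with
  | zero => simp
  | add v v' hv hv' => rw [map_add, map_add, map_add, hv, hv']
  | tmul c g =>
    rw [crossedMul_tmul, crossedMul_tmul]
    have : LinearMap.mulLeft k (1 : A) = LinearMap.id := by ext; simp
    simp [this]

/-- Since `h ▹ 1 = ε(h) 1`, the action factor is the unit for convolution and drops out. -/
theorem crossedMulAux_one {A H : Type*} [Ring A] [HopfAlgebra k A] [Ring H] [HopfAlgebra k H]
    (act : H →ₗ[k] A →ₗ[k] A) (f : H ⊗[k] H →ₗ[k] A)
    (hact : ∀ h : H, act h 1 = counit (R := k) h • (1 : A)) :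
    crossedMulAux act f 1 = TensorProduct.map f (LinearMap.mul' k H) ∘ₗ comul := by
  have h : extendByCounit (act.flip 1) = Algebra.linearMap k A ∘ₗ counit (A := H ⊗[k] H) := by
    ext h h'
    simp [hact, Algebra.algebraMap_eq_smul_one, smul_smul]
  rw [crossedMulAux, h]
  congr 2
  exact congrArg WithConv.ofConv (one_mul (WithConv.toConv f))

/-- With `h ▹ c = ε(h) c` the element `c` is a constant left factor, which passes out of the
convolution. -/
theorem crossedMulAux_trivialAct {A H : Type*} [Ring A] [HopfAlgebra k A] [Ring H]
    [HopfAlgebra k H] (f : H ⊗[k] H →ₗ[k] A) (c : A) :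
    crossedMulAux (trivialAct k A H) f c =
      (LinearMap.mulLeft k c).rTensor H ∘ₗ crossedMulAux (trivialAct k A H) f 1 := by
  have h : extendByCounit ((trivialAct k A H).flip c) =
      LinearMap.mulLeft k c ∘ₗ extendByCounit ((trivialAct k A H).flip 1) := by
    ext h h'
    simp
  have h2 : convMap (LinearMap.mulLeft k c ∘ₗ extendByCounit ((trivialAct k A H).flip 1)) f =
      LinearMap.mulLeft k c ∘ₗ convMap (extendByCounit ((trivialAct k A H).flip 1)) f := by
    rw [convMap_eq, convMap_eq, ← LinearMap.comp_assoc, ← LinearMap.comp_assoc,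
      ← LinearMap.comp_assoc]
    congr 1
    ext a b
    simp
  rw [crossedMulAux, crossedMulAux, h, h2, LinearMap.rTensor, ← LinearMap.comp_assoc,
    ← TensorProduct.map_comp, LinearMap.id_comp]

theorem crossedMul_trivialAct_tmul {A H : Type*} [Ring A] [HopfAlgebra k A] [Ring H]
    [HopfAlgebra k H] (f : H ⊗[k] H →ₗ[k] A) (a c : A) (h h' : H) :
    crossedMul (trivialAct k A H) f (a ⊗ₜ[k] h) (c ⊗ₜ[k] h') =
      (LinearMap.mulLeft k (a * c)).rTensor H
        (TensorProduct.map f (LinearMap.mul' k H) (comul (R := k) (h ⊗ₜ[k] h'))) := by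
  rw [crossedMul_tmul, crossedMulAux_trivialAct, crossedMulAux_one _ _ fun h => rfl,
    LinearMap.comp_apply, LinearMap.comp_apply, ← LinearMap.comp_apply,
    ← LinearMap.rTensor_comp, ← LinearMap.mulLeft_mul]

end TrivialAction

/-! ### Multiplication of monomials. -/

section Mul

open Polynomial

variable {k : Type*} [Field k] {B : Type*} [Ring B] [Algebra k B]

/-- This accounts for the signs in `sweedlerCocycle`: bringing `x' g' x'` to normal form gives `-g'
x'² = -q(y) g'`, whence `f(x, gx) = -q`; the other products of basis elements are reduced in the
same way. -/
theorem sweedlerMap_mul {y g' x' : B} {q : k[X]} (hg : g' * g' = 1)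
    (hx : x' * x' = aeval y q) (hxg : x' * g' = -(g' * x')) (hgy : g' * y = y * g') (h h' : Sweedler k) :
    sweedlerMap g' x' h * sweedlerMap g' x' h' = monomialMap y g' x'
      (TensorProduct.map (sweedlerCocycle q) (LinearMap.mul' k (Sweedler k))
        (comul (R := k) (h ⊗ₜ[k] h'))) := by
  have hgq : g' * aeval y q = aeval y q * g' := (commute_aeval (Commute.symm hgy) q).symm
  have hgq2 : ∀ b, g' * (aeval y q * b) = aeval y q * (g' * b) := fun b => by
    rw [← mul_assoc, hgq, mul_assoc]
  have hg2 : ∀ b, g' * (g' * b) = b := fun b => by rw [← mul_assoc, hg, one_mul]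
  have hxg2 : ∀ b, x' * (g' * b) = -(g' * (x' * b)) := fun b => by
    rw [← mul_assoc, hxg, neg_mul, mul_assoc]
  have e1 : Sweedler.x k * (Sweedler.g k * Sweedler.x k) = 0 := by
    rw [← mul_assoc, Sweedler.x_mul_g, neg_mul, mul_assoc, Sweedler.x_mul_x, mul_zero, neg_zero]
  have e2 : ∀ b, Sweedler.g k * (Sweedler.g k * b) = b := fun b => by
    rw [← mul_assoc, Sweedler.g_mul_g, one_mul]
  -- Both sides are bilinear in `h`, `h'`, which leaves the sixteen pairs of basis elements.
  have key : (LinearMap.mul k B).compl₁₂ (sweedlerMap g' x') (sweedlerMap g' x') =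
      TensorProduct.curry (monomialMap y g' x' ∘ₗ
        TensorProduct.map (sweedlerCocycle q) (LinearMap.mul' k (Sweedler k)) ∘ₗ comul) := by
    apply Sweedler.linearMap_ext <;> apply Sweedler.linearMap_ext <;>
    simp [-Bialgebra.comul_mul, TensorProduct.comul_tmul, Algebra.TensorProduct.one_def,
      TensorProduct.add_tmul,
      TensorProduct.tmul_add, Sweedler.coord_one, Sweedler.coord_g, Sweedler.coord_x,
      Sweedler.coord_g_mul_x, Sweedler.g_mul_g, Sweedler.x_mul_x, Sweedler.x_mul_g, e1, e2,
      mul_assoc, hg, hx, hxg, hgq, hgq2, hg2, hxg2]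
  exact LinearMap.congr_fun₂ key h h'

/-- In an algebra with elements that satisfy the relations of `A_((αᵢ))`, products of monomials are
computed by the multiplication of the crossed product. -/
theorem monomialMap_crossedMul {y g' x' : B} {q : k[X]} (hg : g' * g' = 1)
    (hx : x' * x' = aeval y q) (hxg : x' * g' = -(g' * x')) (hgy : g' * y = y * g')
    (hxy : x' * y = y * x') (u v : k[X] ⊗[k] Sweedler k) :
    monomialMap y g' x' (crossedMul (trivialAct k k[X] (Sweedler k)) (sweedlerCocycle q) u v) =
      monomialMap y g' x' u * monomialMap y g' x' v := by
  have hl : ∀ (P : k[X]) (z : k[X] ⊗[k] Sweedler k),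
      monomialMap y g' x' ((LinearMap.mulLeft k P).rTensor (Sweedler k) z) =
        aeval y P * monomialMap y g' x' z := by
    intro P z
    induction z with
    | zero => simp
    | add z z' h h' => simp only [map_add, mul_add, h, h']
    | tmul Q h => simp [mul_assoc]
  induction u with
  | zero => simp
  | add u u' h h' => simp only [map_add, LinearMap.add_apply, add_mul, h, h']
  | tmul P h =>
    induction v with
    | zero => simp
    | add v v' h h' => simp only [map_add, mul_add, h, h']
    | tmul Q h' =>
      -- Moving `Q(y)` to the left past the image of `h` is the counterpart in `B` of the trivial
      -- action.
      have hc : Commute (aeval y Q) (sweedlerMap g' x' h) :=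
        commute_sweedlerMap (commute_aeval (Commute.symm hgy) Q)
          (commute_aeval (Commute.symm hxy) Q) h
      rw [crossedMul_trivialAct_tmul, hl, ← sweedlerMap_mul hg hx hxg hgy, monomialMap_tmul,
        monomialMap_tmul, map_mul, mul_assoc, mul_assoc, ← mul_assoc (aeval y Q), hc.eq, mul_assoc]

end Mul

/-! ### The basis of `A_((αᵢ))` and its realisation as a crossed product -/

/-- The interchange of middle factors in the coproduct of `C ⊗ D` is the one built into the product
of `B ⊗ B`. Needed for `basisEquiv` to respect `Δ`. -/
theorem TensorProduct.map_mul'_tensorTensorTensorComm {k B C D : Type*} [Field k] [Ring B]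
    [Algebra k B] [AddCommGroup C] [Module k C] [AddCommGroup D] [Module k D] (φ : C →ₗ[k] B)
    (ψ : D →ₗ[k] B) (V : C ⊗[k] C) (U : D ⊗[k] D) :
    TensorProduct.map (LinearMap.mul' k B ∘ₗ TensorProduct.map φ ψ)
        (LinearMap.mul' k B ∘ₗ TensorProduct.map φ ψ)
        (TensorProduct.AlgebraTensorModule.tensorTensorTensorComm k k k k C C D D (V ⊗ₜ[k] U)) =
      TensorProduct.map φ φ V * TensorProduct.map ψ ψ U := by
  induction U with
  | zero => simp
  | add U U' h h' => simp only [TensorProduct.tmul_add, map_add, h, h', mul_add]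
  | tmul b c =>
    induction V with
    | zero => simp
    | add V V' h h' => simp only [TensorProduct.add_tmul, map_add, h, h', add_mul]
    | tmul d e => simp

namespace QAlg

open Polynomial

variable {k : Type*} [Field k] {p : ℕ} (α : ℕ →₀ k)

variable (p) in
/-- The polynomial `Σ αᵢ Y^{pⁱ}`. -/
def poly : k[X] := α.sum fun i c => c • (X : k[X]) ^ p ^ i

theorem aeval_poly {B : Type*} [Ring B] [Algebra k B] (y : B) :
    aeval y (poly p α) = α.sum fun i c => c • y ^ p ^ i := by
  simp [poly, Finsupp.sum]

variable (p) in
/-- The map `k[Y] ⊗ H₄ → A_((αᵢ))` that sends a monomial to the monomial in the generators. -/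
def basisMap : k[X] ⊗[k] Sweedler k →ₗ[k] QAlg k p α :=
  monomialMap (gen k p α .Y) (gen k p α .g) (gen k p α .x)

/-- The bridge along which associativity, units and the bialgebra axioms pass from `A_((αᵢ))` to
`k[Y] ⊗ H₄`, with no direct computation with the cocycle. -/
theorem basisMap_crossedMul (u v : k[X] ⊗[k] Sweedler k) :
    basisMap p α (crossedMul (trivialAct k k[X] (Sweedler k)) (sweedlerCocycle (poly p α)) u v) =
      basisMap p α u * basisMap p α v :=
  monomialMap_crossedMul (g_sq α) ((x_sq α).trans (aeval_poly α _).symm) (x_g α) (g_Y α) (x_Y α)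
    u v

@[simp] theorem basisMap_one_tmul_one :
    basisMap p α (1 ⊗ₜ[k] 1) = 1 := by simp [basisMap]

/-- The image contains the generators and, by `basisMap_crossedMul`, is closed under products. -/
theorem basisMap_surjective : Function.Surjective (basisMap p α) := by
  intro b
  have hb : b ∈ Algebra.adjoin k (Set.range (gen k p α)) := by
    rw [adjoin_gen]; exact Algebra.mem_top
  induction hb using Algebra.adjoin_induction with
  | mem b hb =>
    obtain ⟨_ | _ | _, rfl⟩ := hb
    · exact ⟨X ⊗ₜ[k] 1, by simp [basisMap]⟩
    · exact ⟨1 ⊗ₜ[k] Sweedler.g k, by simp [basisMap]⟩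
    · exact ⟨1 ⊗ₜ[k] Sweedler.x k, by simp [basisMap]⟩
  | algebraMap r =>
    exact ⟨r • (1 ⊗ₜ[k] 1), by rw [map_smul, basisMap_one_tmul_one, Algebra.algebraMap_eq_smul_one]⟩
  | add b c _ _ hb hc =>
    obtain ⟨u, rfl⟩ := hb
    obtain ⟨v, rfl⟩ := hc
    exact ⟨u + v, map_add _ _ _⟩
  | mul b c _ _ hb hc =>
    obtain ⟨u, rfl⟩ := hb
    obtain ⟨v, rfl⟩ := hc
    exact ⟨_, basisMap_crossedMul α u v⟩

variable (p) in
/-- The generators `Y`, `i`, `j` of a quaternion algebra over `k[Y]`. -/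
def quaternionGen : QGen → QuaternionAlgebra k[X] 1 0 (poly p α)
  | .Y => ⟨X, 0, 0, 0⟩
  | .g => ⟨0, 1, 0, 0⟩
  | .x => ⟨0, 0, 1, 0⟩

variable (p) in
/-- The map from `A_((αᵢ))` to the quaternion algebra over `k[Y]` with `i² = 1`,
`j² = Σ αᵢ Y^{pⁱ}`. -/
def toQuaternion : QAlg k p α →ₐ[k] QuaternionAlgebra k[X] 1 0 (poly p α) :=
  lift α (quaternionGen p α)
    (by ext1 <;> simp [quaternionGen])
    (by
      have h : (quaternionGen p α .Y) =
          algebraMap k[X] (QuaternionAlgebra k[X] 1 0 (poly p α)) X := rfl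
      rw [h, ← aeval_poly α, aeval_algebraMap_apply, aeval_X_left_apply]
      ext1 <;> simp [quaternionGen])
    (by ext1 <;> simp [quaternionGen])
    (by ext1 <;> simp [quaternionGen])
    (by ext1 <;> simp [quaternionGen])

/-- The quaternion algebra is free over `k[Y]` on `1, i, j, ij`, and composing with `toQuaternion`
reads off the four coordinates of a tensor. This is the linear independence of the monomials. -/
theorem basisMap_injective : Function.Injective (basisMap p α) := by
  have hY : toQuaternion p α (gen k p α .Y) =
      algebraMap k[X] (QuaternionAlgebra k[X] 1 0 (poly p α)) X := lift_gen ..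
  have hg : toQuaternion p α (gen k p α .g) = ⟨0, 1, 0, 0⟩ := lift_gen ..
  have hx : toQuaternion p α (gen k p α .x) = ⟨0, 0, 1, 0⟩ := lift_gen ..
  have halg : ∀ P : k[X], algebraMap k[X] (QuaternionAlgebra k[X] 1 0 (poly p α)) P =
      ⟨P, 0, 0, 0⟩ := fun _ => rfl
  have key : ∀ z, toQuaternion p α (basisMap p α z) =
      ⟨Sweedler.coeffMap k _ 0 z, Sweedler.coeffMap k _ 1 z, Sweedler.coeffMap k _ 2 z,
        Sweedler.coeffMap k _ 3 z⟩ := by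
    intro z
    rw [basisMap, map_monomialMap, hY, hg, hx]
    conv_lhs => rw [Sweedler.eq_sum_coeffMap z]
    simp only [map_add, monomialMap_tmul, aeval_algebraMap_apply, aeval_X_left_apply,
      sweedlerMap_one, sweedlerMap_g, sweedlerMap_x, sweedlerMap_g_mul_x]
    simp only [halg]
    ext1 <;> simp
  rw [← LinearMap.ker_eq_bot, LinearMap.ker_eq_bot']
  intro z hz
  have h := key z
  rw [hz, map_zero, QuaternionAlgebra.ext_iff] at h
  simp only [QuaternionAlgebra.re_zero, QuaternionAlgebra.imI_zero, QuaternionAlgebra.imJ_zero,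
    QuaternionAlgebra.imK_zero] at h
  rw [Sweedler.eq_sum_coeffMap z, ← h.1, ← h.2.1, ← h.2.2.1, ← h.2.2.2]
  simp

theorem lift_crossedMul (U : (k[X] ⊗[k] Sweedler k) ⊗[k] (k[X] ⊗[k] Sweedler k)) :
    basisMap p α (TensorProduct.lift
        (crossedMul (trivialAct k k[X] (Sweedler k)) (sweedlerCocycle (poly p α))) U) =
      LinearMap.mul' k _ (TensorProduct.map (basisMap p α) (basisMap p α) U) := by
  induction U with
  | zero => simp
  | add U U' h h' => simp only [map_add, h, h']
  | tmul u v => simp [basisMap_crossedMul]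

theorem map_basisMap_map₂ (U V : (k[X] ⊗[k] Sweedler k) ⊗[k] (k[X] ⊗[k] Sweedler k)) :
    TensorProduct.map (basisMap p α) (basisMap p α) (TensorProduct.map₂
        (crossedMul (trivialAct k k[X] (Sweedler k)) (sweedlerCocycle (poly p α)))
        (crossedMul (trivialAct k k[X] (Sweedler k)) (sweedlerCocycle (poly p α))) U V) =
      TensorProduct.map (basisMap p α) (basisMap p α) U *
        TensorProduct.map (basisMap p α) (basisMap p α) V := by
  induction U with
  | zero => simp
  | add U U' h h' => simp only [map_add, LinearMap.add_apply, add_mul, h, h']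
  | tmul a b =>
    induction V with
    | zero => simp
    | add V V' h h' => simp only [map_add, mul_add, h, h']
    | tmul c d => simp [basisMap_crossedMul]

/-! ### The coalgebra `A_((αᵢ))` and the crossed system carried back from it. -/

variable [Fact p.Prime] [CharP k p]

theorem counit_aeval_Y (P : k[X]) :
    counit (R := k) (aeval (gen k p α .Y) P) = counit (R := k) P := by
  have h : (Bialgebra.counitAlgHom k (QAlg k p α)).comp (aeval (gen k p α .Y)) =
      Bialgebra.counitAlgHom k k[X] := by
    ext
    simp [counit_gen, counitGen]
  exact DFunLike.congr_fun h P

theorem comul_aeval_Y (P : k[X]) :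
    comul (R := k) (aeval (gen k p α .Y) P) =
      TensorProduct.map (aeval (gen k p α .Y)).toLinearMap (aeval (gen k p α .Y)).toLinearMap
        (comul (R := k) P) := by
  have h : (Bialgebra.comulAlgHom k (QAlg k p α)).comp (aeval (gen k p α .Y)) =
      (Algebra.TensorProduct.map (aeval (gen k p α .Y)) (aeval (gen k p α .Y))).comp
        (Bialgebra.comulAlgHom k k[X]) := by
    ext
    simp [comul_Y]
  exact DFunLike.congr_fun h P

theorem counit_sweedlerMap (h : Sweedler k) :
    counit (R := k) (sweedlerMap (gen k p α .g) (gen k p α .x) h) = counit (R := k) h := by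
  have key : counit (R := k) ∘ₗ sweedlerMap (gen k p α .g) (gen k p α .x) = counit := by
    apply Sweedler.linearMap_ext <;> simp [counit_gen, counitGen]
  exact LinearMap.congr_fun key h

/-- `sweedlerMap` need not be multiplicative, but compatibility with `Δ` on the four basis elements
uses only `g² = 1`; the value of `x²` does not enter. -/
theorem comul_sweedlerMap (h : Sweedler k) :
    comul (R := k) (sweedlerMap (gen k p α .g) (gen k p α .x) h) =
      TensorProduct.map (sweedlerMap (gen k p α .g) (gen k p α .x))
        (sweedlerMap (gen k p α .g) (gen k p α .x)) (comul (R := k) h) := by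
  have key : comul (R := k) ∘ₗ sweedlerMap (gen k p α .g) (gen k p α .x) =
      TensorProduct.map (sweedlerMap (gen k p α .g) (gen k p α .x))
        (sweedlerMap (gen k p α .g) (gen k p α .x)) ∘ₗ comul := by
    apply Sweedler.linearMap_ext
    · simp [Algebra.TensorProduct.one_def]
    · simp [comul_g]
    · simp [comul_x]
    · rw [LinearMap.comp_apply, LinearMap.comp_apply, Sweedler.comul_g_mul_x]
      simp [comul_g, comul_x, mul_add, g_sq]
  exact LinearMap.congr_fun key h

variable (p) in
/-- `A_((αᵢ))` is isomorphic to `k[Y] ⊗ H₄` as a coalgebra. -/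
def basisEquiv : k[X] ⊗[k] Sweedler k ≃ₗc[k] QAlg k p α :=
  { LinearEquiv.ofBijective (basisMap p α) ⟨basisMap_injective α, basisMap_surjective α⟩ with
    counit_comp := by
      refine TensorProduct.ext' fun P h => ?_
      change counit (R := k) (basisMap p α (P ⊗ₜ[k] h)) = _
      simp [basisMap, counit_aeval_Y, counit_sweedlerMap, mul_comm]
    map_comp_comul := by
      refine TensorProduct.ext' fun P h => ?_
      change TensorProduct.map (basisMap p α) (basisMap p α) (comul (R := k) (P ⊗ₜ[k] h)) =
        comul (R := k) (basisMap p α (P ⊗ₜ[k] h))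
      rw [basisMap, monomialMap_tmul, Bialgebra.comul_mul, comul_aeval_Y, comul_sweedlerMap,
        TensorProduct.comul_tmul]
      exact TensorProduct.map_mul'_tensorTensorTensorComm _ _ _ _ }

@[simp] theorem basisEquiv_apply (z : k[X] ⊗[k] Sweedler k) :
    basisEquiv p α z = basisMap p α z := rfl

theorem map_basisMap_comul (u : k[X] ⊗[k] Sweedler k) :
    TensorProduct.map (basisMap p α) (basisMap p α) (comul (R := k) u) =
      comul (R := k) (basisMap p α u) :=
  LinearMap.congr_fun (basisEquiv p α).map_comp_comul u

theorem counit_basisMap (u : k[X] ⊗[k] Sweedler k) :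
    counit (R := k) (basisMap p α u) = counit (R := k) u :=
  LinearMap.congr_fun (basisEquiv p α).counit_comp u

variable (p) in
/-- The crossed system with trivial action and `f(x, x) = Σ αᵢ Y^{pⁱ}`. -/
def crossedSystem : CrossedSystem k k[X] (Sweedler k) where
  act := trivialAct k k[X] (Sweedler k)
  cocycle := sweedlerCocycle (poly p α)
  act_one h := rfl
  one_act a := by simp
  act_mul a b := by
    rw [convMap_eq]
    refine LinearMap.ext fun h => ?_
    have h1 : ∀ U : Sweedler k ⊗[k] Sweedler k, LinearMap.mul' k k[X] (TensorProduct.map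
        ((trivialAct k k[X] (Sweedler k)).flip a) ((trivialAct k k[X] (Sweedler k)).flip b) U) =
        counit (R := k) (TensorProduct.lid k _ (counit.rTensor _ U)) • (a * b) := by
      intro U
      induction U with
      | zero => simp
      | add U U' h h' => simp only [map_add, add_smul, h, h']
      | tmul c d => simp [smul_smul, mul_comm]
    simp [h1]
  -- This and the remaining axioms hold because their images under the injective map `basisMap` hold
  -- in `A_((αᵢ))`.
  crossed_assoc u v w := by
    apply basisMap_injective (p := p) α
    simp only [basisMap_crossedMul, mul_assoc]
  one_crossed u := by
    apply basisMap_injective (p := p) α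
    rw [basisMap_crossedMul, basisMap_one_tmul_one, one_mul]
  crossed_one u := by
    apply basisMap_injective (p := p) α
    rw [basisMap_crossedMul, basisMap_one_tmul_one, mul_one]
  counit_crossed u v := by
    rw [← counit_basisMap (p := p) α, basisMap_crossedMul, Bialgebra.counit_mul, counit_basisMap,
      counit_basisMap]
  comul_crossed u v := by
    apply (TensorProduct.congr (basisEquiv p α).toLinearEquiv
      (basisEquiv p α).toLinearEquiv).injective
    change TensorProduct.map (basisMap p α) (basisMap p α) _ =
      TensorProduct.map (basisMap p α) (basisMap p α) _
    rw [map_basisMap_map₂, map_basisMap_comul, map_basisMap_comul, map_basisMap_comul,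
      basisMap_crossedMul, Bialgebra.comul_mul]
  exists_antipode := by
    -- The antipode is that of `A_((αᵢ))`, conjugated by `basisEquiv`.
    refine ⟨(basisEquiv p α).symm.toLinearEquiv.toLinearMap ∘ₗ HopfAlgebra.antipode k ∘ₗ
      basisMap p α, fun u => ⟨?_, ?_⟩⟩
    · apply basisMap_injective (p := p) α
      rw [lift_crossedMul, map_smul, basisMap_one_tmul_one, ← counit_basisMap (p := p) α,
        ← Algebra.algebraMap_eq_smul_one, ← HopfAlgebra.mul_antipode_rTensor_comul_apply,
        ← map_basisMap_comul, LinearMap.rTensor, LinearMap.rTensor, TensorProduct.map_map,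
        TensorProduct.map_map]
      congr 3
      refine LinearMap.ext fun z => ?_
      exact (basisEquiv p α).apply_symm_apply _
    · apply basisMap_injective (p := p) α
      rw [lift_crossedMul, map_smul, basisMap_one_tmul_one, ← counit_basisMap (p := p) α,
        ← Algebra.algebraMap_eq_smul_one, ← HopfAlgebra.mul_antipode_lTensor_comul_apply,
        ← map_basisMap_comul, LinearMap.lTensor, LinearMap.lTensor, TensorProduct.map_map,
        TensorProduct.map_map]
      congr 3
      refine LinearMap.ext fun z => ?_
      exact (basisEquiv p α).apply_symm_apply _

end QAlg

/-! ### Recovering a crossed system from its multiplication -/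

namespace TensorProduct

variable {k A H : Type*} [Field k] [Ring A] [Bialgebra k A] [Ring H] [Bialgebra k H]

theorem comul_tmul_one {a b c d e : A} (h : comul (R := k) a = b ⊗ₜ[k] c + d ⊗ₜ[k] e) :
    comul (R := k) (a ⊗ₜ[k] (1 : H)) =
      (b ⊗ₜ[k] (1 : H)) ⊗ₜ[k] (c ⊗ₜ[k] (1 : H)) + (d ⊗ₜ[k] (1 : H)) ⊗ₜ[k] (e ⊗ₜ[k] (1 : H)) := by
  rw [comul_tmul, h, Bialgebra.comul_one, Algebra.TensorProduct.one_def, add_tmul, map_add]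
  rfl

theorem comul_one_tmul {a b c d e : H} (h : comul (R := k) a = b ⊗ₜ[k] c + d ⊗ₜ[k] e) :
    comul (R := k) ((1 : A) ⊗ₜ[k] a) =
      ((1 : A) ⊗ₜ[k] b) ⊗ₜ[k] ((1 : A) ⊗ₜ[k] c) + ((1 : A) ⊗ₜ[k] d) ⊗ₜ[k] ((1 : A) ⊗ₜ[k] e) := by
  rw [comul_tmul, h, Bialgebra.comul_one, Algebra.TensorProduct.one_def, tmul_add, map_add]
  rfl

theorem comul_one_tmul_of_eq_tmul {a b c : H} (h : comul (R := k) a = b ⊗ₜ[k] c) :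
    comul (R := k) ((1 : A) ⊗ₜ[k] a) = ((1 : A) ⊗ₜ[k] b) ⊗ₜ[k] ((1 : A) ⊗ₜ[k] c) := by
  rw [comul_tmul, h, Bialgebra.comul_one, Algebra.TensorProduct.one_def]
  rfl

end TensorProduct

namespace CrossedSystem

section General

variable {k A H : Type*} [Field k] [Ring A] [HopfAlgebra k A] [Ring H] [HopfAlgebra k H]
  (S : CrossedSystem k A H)

/-- Applying `id ⊗ ε` turns the component `h₍₃₎ g₍₂₎` into counits, which the counit axiom absorbs.
What remains shows the action (for `g = 1`) and the cocycle (for `c = 1`). -/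
theorem lTensor_counit_crossedMul (act : H →ₗ[k] A →ₗ[k] A) (f : H ⊗[k] H →ₗ[k] A) (c : A)
    (h g : H) :
    TensorProduct.rid k A (counit.lTensor A (crossedMul act f (1 ⊗ₜ[k] h) (c ⊗ₜ[k] g))) =
      convMap (extendByCounit (act.flip c)) f (h ⊗ₜ[k] g) := by
  have h1 : LinearMap.mulLeft k (1 : A) = LinearMap.id := by ext; simp
  rw [crossedMul_tmul, h1, LinearMap.rTensor_id, LinearMap.id_apply, crossedMulAux]
  generalize convMap (extendByCounit (act.flip c)) f = F
  generalize h ⊗ₜ[k] g = u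
  have h2 : ∀ U : (H ⊗[k] H) ⊗[k] (H ⊗[k] H),
      TensorProduct.rid k A (counit.lTensor A (TensorProduct.map F (LinearMap.mul' k H) U)) =
        F (TensorProduct.rid k _ (counit.lTensor _ U)) := by
    intro U
    induction U with
    | zero => simp
    | add U V hU hV => simp only [map_add, hU, hV]
    | tmul a b =>
      have hb : counit (R := k) (LinearMap.mul' k H b) = counit (R := k) b := by
        induction b with
        | zero => simp
        | add b c hb hc => simp only [map_add, hb, hc]
        | tmul b c => simp [mul_comm]
      simp [hb]
  rw [LinearMap.comp_apply, h2]
  simp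

theorem convMap_extendByCounit_one :
    convMap (extendByCounit (S.act.flip 1)) S.cocycle = S.cocycle := by
  have h : extendByCounit (S.act.flip 1) = Algebra.linearMap k A ∘ₗ counit (A := H ⊗[k] H) := by
    ext h h'
    simp [S.act_one, Algebra.algebraMap_eq_smul_one, smul_smul]
  rw [h]
  exact congrArg WithConv.ofConv (one_mul (WithConv.toConv S.cocycle))

theorem lTensor_counit_crossedMul_one (h g : H) :
    TensorProduct.rid k A (counit.lTensor A
      (crossedMul S.act S.cocycle (1 ⊗ₜ[k] h) (1 ⊗ₜ[k] g))) = S.cocycle (h ⊗ₜ[k] g) := by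
  rw [lTensor_counit_crossedMul, convMap_extendByCounit_one]

theorem cocycle_one_right (h : H) :
    S.cocycle (h ⊗ₜ[k] 1) = counit (R := k) h • (1 : A) := by
  rw [← lTensor_counit_crossedMul_one, S.crossed_one]
  simp

/-- The right unit axiom gives `f(h, 1) = ε(h) 1`, so with `1` in the second `H` slot the cocycle
disappears. -/
theorem lTensor_counit_crossedMul_act (h : H) (c : A) :
    TensorProduct.rid k A (counit.lTensor A
      (crossedMul S.act S.cocycle (1 ⊗ₜ[k] h) (c ⊗ₜ[k] 1))) = S.act h c := by
  rw [lTensor_counit_crossedMul, convMap_eq, LinearMap.comp_apply, LinearMap.comp_apply,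
    TensorProduct.comul_tmul, Bialgebra.comul_one, Algebra.TensorProduct.one_def]
  have h2 : ∀ U : H ⊗[k] H,
      LinearMap.mul' k A (TensorProduct.map (extendByCounit (S.act.flip c)) S.cocycle
        (TensorProduct.AlgebraTensorModule.tensorTensorTensorComm k k k k H H H H
          (U ⊗ₜ[k] ((1 : H) ⊗ₜ[k] (1 : H))))) =
        S.act (TensorProduct.rid k _ (counit.lTensor _ U)) c := by
    intro U
    induction U with
    | zero => simp
    | add U V hU hV =>
      simp only [TensorProduct.add_tmul, map_add, hU, hV, LinearMap.add_apply]
    | tmul a b => simp [cocycle_one_right]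
  rw [h2]
  simp

/-- The action and the cocycle are determined by the multiplication. -/
theorem ext_of_crossedMul {S T : CrossedSystem k A H}
    (h : crossedMul S.act S.cocycle = crossedMul T.act T.cocycle) : S = T := by
  refine CrossedSystem.ext ?_ ?_
  · ext a c
    rw [← lTensor_counit_crossedMul_act, ← lTensor_counit_crossedMul_act, h]
  · refine TensorProduct.ext' fun a b => ?_
    rw [← lTensor_counit_crossedMul_one, ← lTensor_counit_crossedMul_one, h]

theorem tmul_one_mul_tmul (a c : A) (h : H) :
    S.tmul a 1 * S.tmul c h = S.tmul (a * c) h := by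
  refine (crossedMul_tmul_left S.act S.cocycle a 1 (c ⊗ₜ[k] h)).trans ?_
  rw [S.one_crossed]
  simp [tmul]

theorem tmul_mul_tmul_one (h h' : H) :
    S.tmul 1 h * S.tmul 1 h' =
      (TensorProduct.map S.cocycle (LinearMap.mul' k H) (comul (R := k) (h ⊗ₜ[k] h')) :
        A ⊗[k] H) := by
  have h1 : LinearMap.mulLeft k (1 : A) = LinearMap.id := by ext; simp
  refine (crossedMul_tmul S.act S.cocycle 1 1 h h').trans ?_
  rw [h1, LinearMap.rTensor_id, LinearMap.id_apply, crossedMulAux_one _ _ S.act_one,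
    LinearMap.comp_apply]

/-- The embedding `a ↦ a # 1`. -/
def inl : A →ₐ[k] S.Product :=
  AlgHom.ofLinearMap ((TensorProduct.mk k A H).flip 1 : A →ₗ[k] A ⊗[k] H) rfl
    fun a b => (S.tmul_one_mul_tmul a b 1).symm

theorem inl_apply (a : A) : S.inl a = S.tmul a 1 := rfl

theorem counit_tmul (a : A) (h : H) :
    counit (R := k) (S.tmul a h) = counit (R := k) h * counit (R := k) a := rfl

theorem comul_tmul_one {a b c d e : A}
    (h : comul (R := k) a = b ⊗ₜ[k] c + d ⊗ₜ[k] e) : comul (R := k) (S.tmul a 1) =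
      S.tmul b 1 ⊗ₜ[k] S.tmul c 1 + S.tmul d 1 ⊗ₜ[k] S.tmul e 1 :=
  TensorProduct.comul_tmul_one h

theorem comul_one_tmul {a b c d e : H}
    (h : comul (R := k) a = b ⊗ₜ[k] c + d ⊗ₜ[k] e) : comul (R := k) (S.tmul 1 a) =
      S.tmul 1 b ⊗ₜ[k] S.tmul 1 c + S.tmul 1 d ⊗ₜ[k] S.tmul 1 e :=
  TensorProduct.comul_one_tmul h

theorem comul_one_tmul_of_eq_tmul {a b c : H} (h : comul (R := k) a = b ⊗ₜ[k] c) :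
    comul (R := k) (S.tmul 1 a) = S.tmul 1 b ⊗ₜ[k] S.tmul 1 c :=
  TensorProduct.comul_one_tmul_of_eq_tmul h

end General

/-! ### Crossed products of `k[Y]` and `H₄` -/

section Sweedler

open Polynomial

variable {k : Type*} [Field k] (S : CrossedSystem k k[X] (Sweedler k))

/-- The element `Y # 1`. -/
def eltY : S.Product := S.tmul X 1

/-- The element `1 # g`. -/
def eltG : S.Product := S.tmul 1 (Sweedler.g k)

/-- The element `1 # x`. -/
def eltX : S.Product := S.tmul 1 (Sweedler.x k)

theorem comul_eltY : comul (R := k) S.eltY = S.eltY ⊗ₜ[k] 1 + 1 ⊗ₜ[k] S.eltY :=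
  S.comul_tmul_one comul_X

theorem comul_eltG : comul (R := k) S.eltG = S.eltG ⊗ₜ[k] S.eltG :=
  S.comul_one_tmul_of_eq_tmul (Sweedler.comul_g k)

theorem comul_eltX : comul (R := k) S.eltX = S.eltX ⊗ₜ[k] 1 + S.eltG ⊗ₜ[k] S.eltX :=
  S.comul_one_tmul (Sweedler.comul_x k)

theorem comul_tmul_g_mul_x : comul (R := k) (S.tmul 1 (Sweedler.g k * Sweedler.x k)) =
    S.tmul 1 (Sweedler.g k * Sweedler.x k) ⊗ₜ[k] S.eltG +
      1 ⊗ₜ[k] S.tmul 1 (Sweedler.g k * Sweedler.x k) :=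
  S.comul_one_tmul Sweedler.comul_g_mul_x

/-- The coordinates of an element of a crossed product. -/
def coeffProd (i : Fin 4) : S.Product →ₗ[k] k[X] := Sweedler.coeffMap k k[X] i

@[simp] theorem coeffProd_tmul (i : Fin 4) (a : k[X]) (h : Sweedler k) :
    S.coeffProd i (S.tmul a h) = Sweedler.coord k i h • a := Sweedler.coeffMap_tmul i a h

theorem map_coeffProd_comul (i j : Fin 4) (z : S.Product) :
    TensorProduct.map (S.coeffProd i) (S.coeffProd j) (comul (R := k) z) =
      if i = 0 ∧ j = 0 then comul (R := k) (S.coeffProd 0 z)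
      else if i = 1 ∧ j = 1 then comul (R := k) (S.coeffProd 1 z)
      else if (i = 2 ∧ j = 0) ∨ (i = 1 ∧ j = 2) then comul (R := k) (S.coeffProd 2 z)
      else if (i = 3 ∧ j = 1) ∨ (i = 0 ∧ j = 3) then comul (R := k) (S.coeffProd 3 z)
      else 0 := Sweedler.map_coeffMap_comul i j z

theorem eq_zero_of_one_tmul_eq_zero {a : k[X]} (h : (1 : k[X]) ⊗ₜ[k] a = 0) : a = 0 := by
  simpa using congrArg (TensorProduct.lid k k[X] ∘ (counit (R := k)).rTensor k[X]) h

/-- An element `t # 1` with `Δ(t # 1) = (t # 1) ⊗ 1 + g ⊗ (t # 1) + x ⊗ (c # 1)` vanishes, and so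
does `c`. -/
theorem eq_zero_of_comul {t c : k[X]} (h : comul (R := k) (S.tmul t 1) =
    S.tmul t 1 ⊗ₜ[k] 1 + S.eltG ⊗ₜ[k] S.tmul t 1 + S.eltX ⊗ₜ[k] S.tmul c 1) :
    t = 0 ∧ c = 0 := by
  constructor
  -- The left side has only a `(1, 1)` component, so the `(g, 1)` component isolates `1 ⊗ t`; below,
  -- the `(x, 1)` component isolates `1 ⊗ c`.
  · have h1 := congrArg (TensorProduct.map (S.coeffProd 1) (S.coeffProd 0)) h
    rw [map_coeffProd_comul] at h1
    simp [eltG, eltX, Sweedler.coord_one, Sweedler.coord_g, Sweedler.coord_x] at h1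
    exact eq_zero_of_one_tmul_eq_zero h1.symm
  · have h1 := congrArg (TensorProduct.map (S.coeffProd 2) (S.coeffProd 0)) h
    rw [map_coeffProd_comul] at h1
    simp [eltG, eltX, Sweedler.coord_one, Sweedler.coord_g, Sweedler.coord_x] at h1
    exact eq_zero_of_one_tmul_eq_zero h1.symm

theorem eq_zero_of_comul' {t : k[X]} (h : comul (R := k) (S.tmul t 1) =
    S.tmul t 1 ⊗ₜ[k] 1 + S.eltG ⊗ₜ[k] S.tmul t 1) : t = 0 := by
  refine (S.eq_zero_of_comul (t := t) (c := 0) ?_).1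
  have h0 : S.tmul 0 1 = 0 := TensorProduct.zero_tmul _ _
  rw [h, h0, TensorProduct.tmul_zero, add_zero]

theorem eltG_mul_eltG_eq_tmul :
    S.eltG * S.eltG = S.tmul (S.cocycle (Sweedler.g k ⊗ₜ[k] Sweedler.g k)) 1 := by
  refine (S.tmul_mul_tmul_one _ _).trans ?_
  simp [TensorProduct.comul_tmul, Sweedler.g_mul_g, tmul]
  rfl

/-- The square of a group-like element is group-like, so `f(g, g)` is group-like in `k[Y]`, where
`1` is the only such element. -/
theorem eltG_mul_eltG : S.eltG * S.eltG = 1 := by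
  have h : S.cocycle (Sweedler.g k ⊗ₜ[k] Sweedler.g k) = 1 := by
    refine eq_one_of_isGroupLikeElem (k := k) ⟨?_, ?_⟩
    · have h1 := congrArg (counit (R := k)) S.eltG_mul_eltG_eq_tmul
      rw [Bialgebra.counit_mul, counit_tmul, eltG, counit_tmul] at h1
      simpa using h1.symm
    · have h1 := congrArg (comul (R := k)) S.eltG_mul_eltG_eq_tmul
      rw [Bialgebra.comul_mul, comul_eltG, Algebra.TensorProduct.tmul_mul_tmul,
        eltG_mul_eltG_eq_tmul] at h1
      have h2 := congrArg (TensorProduct.map (S.coeffProd 0) (S.coeffProd 0)) h1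
      rw [map_coeffProd_comul] at h2
      simpa [Sweedler.coord_one] using h2.symm
  rw [eltG_mul_eltG_eq_tmul, h]
  rfl

theorem eltG_mul_mul_eltG (a : S.Product) : a * S.eltG * S.eltG = a := by
  rw [mul_assoc, eltG_mul_eltG, mul_one]

theorem tmul_g (a : k[X]) : S.tmul a (Sweedler.g k) = S.tmul a 1 * S.eltG := by
  rw [eltG, tmul_one_mul_tmul, mul_one]

theorem tmul_x (a : k[X]) : S.tmul a (Sweedler.x k) = S.tmul a 1 * S.eltX := by
  rw [eltX, tmul_one_mul_tmul, mul_one]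

theorem eltG_mul_eltY_eq_tmul :
    S.eltG * S.eltY = S.tmul (S.act (Sweedler.g k) X) 1 * S.eltG := by
  rw [← tmul_g]
  refine (crossedMul_tmul S.act S.cocycle 1 X (Sweedler.g k) 1).trans ?_
  simp [crossedMulAux, convMap_eq, TensorProduct.comul_tmul, Algebra.TensorProduct.one_def, tmul,
    cocycle_one_right]

theorem eltX_mul_eltY_eq_tmul :
    S.eltX * S.eltY = S.tmul (S.act (Sweedler.x k) X) 1 +
      S.tmul (S.act (Sweedler.g k) X) 1 * S.eltX := by
  rw [← tmul_x]
  refine (crossedMul_tmul S.act S.cocycle 1 X (Sweedler.x k) 1).trans ?_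
  simp [crossedMulAux, convMap_eq, TensorProduct.comul_tmul, Algebra.TensorProduct.one_def, tmul,
    cocycle_one_right, TensorProduct.add_tmul]
  rfl

/-- Put `Γ = gYg⁻¹ = (g ▹ Y) # 1`, which is primitive, and `W = xY - Γx = (x ▹ Y) # 1`. Then `Δ W =
W ⊗ 1 + g ⊗ W + x ⊗ (Y - Γ)`, and `eq_zero_of_comul` gives `W = 0` and `Γ = Y` together. -/
theorem act_generators : S.act (Sweedler.x k) X = 0 ∧ S.act (Sweedler.g k) X = X := by
  set Γ : S.Product := S.tmul (S.act (Sweedler.g k) X) 1 with hΓ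
  set W : S.Product := S.tmul (S.act (Sweedler.x k) X) 1 with hW
  have hG : S.eltG * S.eltY = Γ * S.eltG := S.eltG_mul_eltY_eq_tmul
  have hX : S.eltX * S.eltY = W + Γ * S.eltX := S.eltX_mul_eltY_eq_tmul
  have hΓ' : Γ = S.eltG * S.eltY * S.eltG := by rw [hG, eltG_mul_mul_eltG]
  have hcΓ : comul (R := k) Γ = Γ ⊗ₜ[k] 1 + 1 ⊗ₜ[k] Γ := by
    rw [hΓ', Bialgebra.comul_mul, Bialgebra.comul_mul, comul_eltG, comul_eltY]
    simp [mul_add, add_mul, eltG_mul_eltG]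
  have hGΓ : Γ * S.eltG = S.eltG * S.eltY := hG.symm
  have hcW : comul (R := k) W = W ⊗ₜ[k] 1 + S.eltG ⊗ₜ[k] W + S.eltX ⊗ₜ[k] (S.eltY - Γ) := by
    have hW' : W = S.eltX * S.eltY - Γ * S.eltX := by rw [hX, add_sub_cancel_right]
    conv_lhs => rw [hW', map_sub, Bialgebra.comul_mul, Bialgebra.comul_mul, comul_eltX, comul_eltY,
      hcΓ]
    simp only [mul_add, add_mul, Algebra.TensorProduct.tmul_mul_tmul, mul_one, one_mul, hX, hGΓ,
      TensorProduct.add_tmul, TensorProduct.tmul_add, TensorProduct.tmul_sub]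
    abel
  have hs : S.eltY - Γ = S.tmul (X - S.act (Sweedler.g k) X) 1 :=
    (TensorProduct.sub_tmul X (S.act (Sweedler.g k) X) (1 : Sweedler k)).symm
  rw [hs] at hcW
  obtain ⟨h1, h2⟩ := S.eq_zero_of_comul hcW
  exact ⟨h1, (sub_eq_zero.1 h2).symm⟩

theorem eltG_mul_eltY : S.eltG * S.eltY = S.eltY * S.eltG := by
  rw [eltG_mul_eltY_eq_tmul, S.act_generators.2]
  rfl

theorem eltX_mul_eltY : S.eltX * S.eltY = S.eltY * S.eltX := by
  have h0 : S.tmul 0 1 = 0 := TensorProduct.zero_tmul _ _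
  rw [eltX_mul_eltY_eq_tmul, S.act_generators.2, S.act_generators.1, h0, zero_add]
  rfl

theorem cocycle_g_g : S.cocycle (Sweedler.g k ⊗ₜ[k] Sweedler.g k) = 1 := by
  have h := congrArg (S.coeffProd 0) (S.eltG_mul_eltG_eq_tmul.symm.trans S.eltG_mul_eltG)
  simpa [one_def, Sweedler.coord_one] using h

theorem eltG_mul_eltX_eq_tmul : S.eltG * S.eltX =
    S.tmul (S.cocycle (Sweedler.g k ⊗ₜ[k] Sweedler.x k)) 1 * S.eltG +
      S.tmul 1 (Sweedler.g k * Sweedler.x k) := by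
  rw [← tmul_g]
  refine (S.tmul_mul_tmul_one _ _).trans ?_
  simp [TensorProduct.comul_tmul, TensorProduct.tmul_add, tmul, cocycle_g_g]
  rfl

/-- The product `g · x` and the tensor `1 # gx` have coproducts of the same shape, so their
difference `d` satisfies `Δ d = d ⊗ g + 1 ⊗ d`. Hence `dg = f(g, x) # 1` satisfies `Δ(dg) = dg ⊗ 1 +
g ⊗ dg` and vanishes. -/
theorem eltG_mul_eltX : S.eltG * S.eltX = S.tmul 1 (Sweedler.g k * Sweedler.x k) := by
  have h := S.eltG_mul_eltX_eq_tmul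
  have ht : S.cocycle (Sweedler.g k ⊗ₜ[k] Sweedler.x k) = 0 := by
    refine S.eq_zero_of_comul' ?_
    set t := S.tmul (S.cocycle (Sweedler.g k ⊗ₜ[k] Sweedler.x k)) 1 with ht
    have h1 : t = (S.eltG * S.eltX - S.tmul 1 (Sweedler.g k * Sweedler.x k)) * S.eltG := by
      rw [h, add_sub_cancel_right, eltG_mul_mul_eltG]
    rw [h1, Bialgebra.comul_mul, map_sub, Bialgebra.comul_mul, comul_eltG, comul_eltX,
      comul_tmul_g_mul_x]
    simp only [mul_add, sub_mul, add_mul, Algebra.TensorProduct.tmul_mul_tmul, mul_one, one_mul,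
      eltG_mul_eltG, TensorProduct.sub_tmul, TensorProduct.tmul_sub]
    abel
  have h0 : S.tmul 0 1 = 0 := TensorProduct.zero_tmul _ _
  rw [h, ht, h0, zero_mul, zero_add]

theorem eltX_mul_eltG_eq_tmul : S.eltX * S.eltG =
    S.tmul (S.cocycle (Sweedler.x k ⊗ₜ[k] Sweedler.g k)) 1 * S.eltG -
      S.tmul 1 (Sweedler.g k * Sweedler.x k) := by
  rw [← tmul_g]
  refine (S.tmul_mul_tmul_one _ _).trans ?_
  simp [TensorProduct.comul_tmul, Sweedler.x_mul_g, TensorProduct.add_tmul, tmul, cocycle_g_g,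
    TensorProduct.tmul_neg]
  rfl

/-- As for `eltG_mul_eltX`: here `(xg + gx)g = f(x, g) # 1` has a coproduct that forces it to
vanish. -/
theorem eltX_mul_eltG : S.eltX * S.eltG = -(S.eltG * S.eltX) := by
  have h := S.eltX_mul_eltG_eq_tmul
  rw [← eltG_mul_eltX] at h
  have ht : S.cocycle (Sweedler.x k ⊗ₜ[k] Sweedler.g k) = 0 := by
    refine S.eq_zero_of_comul' ?_
    set t := S.tmul (S.cocycle (Sweedler.x k ⊗ₜ[k] Sweedler.g k)) 1 with ht
    have h1 : t = (S.eltX * S.eltG + S.eltG * S.eltX) * S.eltG := by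
      rw [h, sub_add_cancel, eltG_mul_mul_eltG]
    rw [h1, Bialgebra.comul_mul, map_add, Bialgebra.comul_mul, Bialgebra.comul_mul, comul_eltG,
      comul_eltX]
    simp only [mul_add, add_mul, Algebra.TensorProduct.tmul_mul_tmul, mul_one, one_mul,
      eltG_mul_eltG, TensorProduct.add_tmul, TensorProduct.tmul_add]
    abel
  have h0 : S.tmul 0 1 = 0 := TensorProduct.zero_tmul _ _
  rw [h, ht, h0, zero_mul, zero_sub]

theorem cocycle_x_g_and_cocycle_g_x : S.cocycle (Sweedler.x k ⊗ₜ[k] Sweedler.g k) = 0 ∧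
    S.cocycle (Sweedler.g k ⊗ₜ[k] Sweedler.x k) = 0 := by
  have h1 := S.lTensor_counit_crossedMul_one (Sweedler.g k) (Sweedler.x k)
  have h2 := S.lTensor_counit_crossedMul_one (Sweedler.x k) (Sweedler.g k)
  have e1 : crossedMul S.act S.cocycle (1 ⊗ₜ[k] Sweedler.g k) (1 ⊗ₜ[k] Sweedler.x k) =
      1 ⊗ₜ[k] (Sweedler.g k * Sweedler.x k) := S.eltG_mul_eltX
  have e2 : crossedMul S.act S.cocycle (1 ⊗ₜ[k] Sweedler.x k) (1 ⊗ₜ[k] Sweedler.g k) =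
      -(1 ⊗ₜ[k] (Sweedler.g k * Sweedler.x k)) :=
    S.eltX_mul_eltG.trans (congrArg Neg.neg S.eltG_mul_eltX)
  rw [e1] at h1
  rw [e2] at h2
  exact ⟨by simpa using h2.symm, by simpa using h1.symm⟩

/-- Of the four terms of the product, the mixed ones vanish with `f(x, g)` and `f(g, x)`, and the
last one because `x² = 0` in `H₄`. -/
theorem eltX_mul_eltX : S.eltX * S.eltX =
    S.tmul (S.cocycle (Sweedler.x k ⊗ₜ[k] Sweedler.x k)) 1 := by
  refine (S.tmul_mul_tmul_one _ _).trans ?_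
  simp [TensorProduct.comul_tmul, Sweedler.x_mul_x, TensorProduct.add_tmul, TensorProduct.tmul_add,
    tmul, S.cocycle_x_g_and_cocycle_g_x.1, S.cocycle_x_g_and_cocycle_g_x.2]
  rfl

/-- In `(x ⊗ 1 + g ⊗ x)²` the mixed terms cancel by `xg = -gx`, and `g² = 1`; so `x²` is primitive.
-/
theorem comul_cocycle_x_x :
    comul (R := k) (S.cocycle (Sweedler.x k ⊗ₜ[k] Sweedler.x k)) =
      S.cocycle (Sweedler.x k ⊗ₜ[k] Sweedler.x k) ⊗ₜ[k] 1 +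
        1 ⊗ₜ[k] S.cocycle (Sweedler.x k ⊗ₜ[k] Sweedler.x k) := by
  have h : comul (R := k) (S.eltX * S.eltX) =
      (S.eltX * S.eltX) ⊗ₜ[k] 1 + 1 ⊗ₜ[k] (S.eltX * S.eltX) := by
    rw [Bialgebra.comul_mul, comul_eltX]
    simp only [mul_add, add_mul, Algebra.TensorProduct.tmul_mul_tmul, mul_one, one_mul,
      eltG_mul_eltG, eltX_mul_eltG, TensorProduct.neg_tmul]
    abel
  rw [eltX_mul_eltX] at h
  have h2 := congrArg (TensorProduct.map (S.coeffProd 0) (S.coeffProd 0)) h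
  rw [map_coeffProd_comul] at h2
  simpa [Sweedler.coord_one, one_def] using h2

theorem aeval_eltY (P : k[X]) : aeval S.eltY P = S.tmul P 1 := by
  have h : aeval S.eltY = S.inl := by
    ext
    simp [inl_apply, eltY]
  rw [h, inl_apply]

/-- In a crossed product of `k[Y]` and `H₄`, the monomials in the generators are the pure
tensors. -/
theorem monomialMap_elt (z : k[X] ⊗[k] Sweedler k) :
    monomialMap S.eltY S.eltG S.eltX z = (show S.Product from z) := by
  induction z with
  | zero => exact map_zero _
  | add z z' h h' => rw [map_add, h, h']; rfl
  | tmul P h =>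
    have h2 : sweedlerMap S.eltG S.eltX =
        (TensorProduct.mk k k[X] (Sweedler k) 1 : Sweedler k →ₗ[k] S.Product) := by
      apply Sweedler.linearMap_ext
      · rw [sweedlerMap_one]; rfl
      · rw [sweedlerMap_g]; rfl
      · rw [sweedlerMap_x]; rfl
      · rw [sweedlerMap_g_mul_x, eltG_mul_eltX]; rfl
    rw [monomialMap_tmul, h2, aeval_eltY]
    refine (S.tmul_one_mul_tmul P 1 h).trans ?_
    rw [mul_one]
    rfl

/-- A crossed system on `k[Y]` and `H₄` is determined by `f(x, x)`. -/
theorem crossedMul_eq : crossedMul S.act S.cocycle =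
    crossedMul (trivialAct k k[X] (Sweedler k))
      (sweedlerCocycle (S.cocycle (Sweedler.x k ⊗ₜ[k] Sweedler.x k))) := by
  refine LinearMap.ext fun u => LinearMap.ext fun v => ?_
  -- The generators satisfy the relations with `q = f(x, x)`, and the monomial map into `S.Product`
  -- is the identity of the underlying space, so the two products coincide.
  have h := monomialMap_crossedMul S.eltG_mul_eltG
    (S.eltX_mul_eltX.trans (S.aeval_eltY _).symm) S.eltX_mul_eltG S.eltG_mul_eltY
    S.eltX_mul_eltY u v
  rw [monomialMap_elt, monomialMap_elt, monomialMap_elt] at h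
  exact h.symm

theorem eq_of_cocycle_x_x {S T : CrossedSystem k k[X] (Sweedler k)}
    (h : S.cocycle (Sweedler.x k ⊗ₜ[k] Sweedler.x k) =
      T.cocycle (Sweedler.x k ⊗ₜ[k] Sweedler.x k)) : S = T :=
  ext_of_crossedMul (by rw [crossedMul_eq, crossedMul_eq, h])

end Sweedler

end CrossedSystem

/-! ### Hopf algebra maps out of `A_((αᵢ))` -/

namespace QAlg

open Polynomial

section Model

variable {k : Type*} [Field k] {p : ℕ} {α : ℕ →₀ k} {B : Type*} [Ring B] [Bialgebra k B]

variable (p) in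
/-- Elements of a bialgebra that satisfy the relations of `A_((αᵢ))` and have the coproducts of its
generators. -/
structure IsModel (α : ℕ →₀ k) (v : QGen → B) : Prop where
  g_sq : v .g * v .g = 1
  x_sq : v .x * v .x = aeval (v .Y) (poly p α)
  x_g : v .x * v .g = -(v .g * v .x)
  g_Y : v .g * v .Y = v .Y * v .g
  x_Y : v .x * v .Y = v .Y * v .x
  comul_Y : comul (R := k) (v .Y) = v .Y ⊗ₜ[k] 1 + 1 ⊗ₜ[k] v .Y
  comul_g : comul (R := k) (v .g) = v .g ⊗ₜ[k] v .g
  comul_x : comul (R := k) (v .x) = v .x ⊗ₜ[k] 1 + v .g ⊗ₜ[k] v .x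
  counit : ∀ t, counit (R := k) (v t) = counitGen k t

variable [Fact p.Prime] [CharP k p]

theorem isModel_gen (α : ℕ →₀ k) : IsModel p α (gen k p α) where
  g_sq := g_sq α
  x_sq := (x_sq α).trans (aeval_poly α _).symm
  x_g := x_g α
  g_Y := g_Y α
  x_Y := x_Y α
  comul_Y := comul_Y α
  comul_g := comul_g α
  comul_x := comul_x α
  counit := counit_gen α

namespace IsModel

variable {v : QGen → B} (hv : IsModel p α v)

/-- The bialgebra map out of `A_((αᵢ))` with prescribed values on the generators. -/
def hom : QAlg k p α →ₐc[k] B :=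
  BialgHom.ofAlgHom (lift α v hv.g_sq (hv.x_sq.trans (aeval_poly α _)) hv.x_g hv.g_Y hv.x_Y)
    (algHom_ext α fun t => by
      simp only [AlgHom.comp_apply, lift_gen, Bialgebra.counitAlgHom_apply, hv.counit, counit_gen])
    (algHom_ext α fun t => by
      simp only [AlgHom.comp_apply, lift_gen, Bialgebra.comulAlgHom_apply]
      rcases t with _ | _ | _
      · simp [QAlg.comul_Y, hv.comul_Y, lift_gen]
      · simp [QAlg.comul_g, hv.comul_g, lift_gen]
      · simp [QAlg.comul_x, hv.comul_x, lift_gen])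

@[simp] theorem hom_gen (t : QGen) : hv.hom (gen k p α t) = v t := lift_gen ..

theorem hom_basisMap (z : k[X] ⊗[k] Sweedler k) :
    hv.hom (basisMap p α z) = monomialMap (v .Y) (v .g) (v .x) z := by
  have h := map_monomialMap (hv.hom : QAlg k p α →ₐ[k] B) (gen k p α .Y) (gen k p α .g)
    (gen k p α .x) z
  simpa [basisMap] using! h

theorem hom_bijective (h : Function.Bijective (monomialMap (k := k) (v .Y) (v .g) (v .x))) :
    Function.Bijective hv.hom := by
  have h1 : (hv.hom : QAlg k p α → B) ∘ basisMap p α = monomialMap (v .Y) (v .g) (v .x) :=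
    funext hv.hom_basisMap
  rw [← h1] at h
  exact (Function.Bijective.of_comp_iff _
    ⟨basisMap_injective α, basisMap_surjective α⟩).1 h

/-- If the monomials in the given elements form a basis, then `A_((αᵢ))` is isomorphic to the given
bialgebra. -/
def equiv (h : Function.Bijective (monomialMap (k := k) (v .Y) (v .g) (v .x))) :
    QAlg k p α ≃ₐc[k] B :=
  BialgEquiv.ofBijective hv.hom (hv.hom_bijective h)

end IsModel

theorem bialgHom_ext {φ ψ : QAlg k p α →ₐc[k] B} (h : ∀ t, φ (gen k p α t) = ψ (gen k p α t)) :
    φ = ψ :=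
  BialgHom.coe_toAlgHom_injective (algHom_ext α h)

theorem bialgEquiv_ext {φ ψ : QAlg k p α ≃ₐc[k] B}
    (h : ∀ t, φ (gen k p α t) = ψ (gen k p α t)) : φ = ψ :=
  BialgEquiv.toBialgHom_injective (bialgHom_ext h)

end Model

variable {k : Type*} [Field k] {p : ℕ}

variable (k) in
/-- The elements `Y ⊗ 1`, `1 ⊗ g`, `1 ⊗ x` of `k[Y] ⊗ H₄`. -/
def tensorGen : QGen → k[X] ⊗[k] Sweedler k
  | .Y => X ⊗ₜ[k] 1
  | .g => 1 ⊗ₜ[k] Sweedler.g k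
  | .x => 1 ⊗ₜ[k] Sweedler.x k

variable (k p) in
theorem isModel_tensorGen : IsModel p (0 : ℕ →₀ k) (tensorGen k) where
  g_sq := by simp [tensorGen, Sweedler.g_mul_g, Algebra.TensorProduct.one_def]
  x_sq := by simp [tensorGen, Sweedler.x_mul_x, poly]
  x_g := by simp [tensorGen, Sweedler.x_mul_g, TensorProduct.tmul_neg]
  g_Y := by simp [tensorGen]
  x_Y := by simp [tensorGen]
  comul_Y := TensorProduct.comul_tmul_one comul_X
  comul_g := TensorProduct.comul_one_tmul_of_eq_tmul (Sweedler.comul_g k)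
  comul_x := TensorProduct.comul_one_tmul (Sweedler.comul_x k)
  counit := by rintro (_ | _ | _) <;> simp [tensorGen, counitGen]

variable [Fact p.Prime] [CharP k p] (α : ℕ →₀ k)

variable (k) in
theorem monomialMap_tensorGen :
    monomialMap (tensorGen k .Y) (tensorGen k .g) (tensorGen k .x) = LinearMap.id := by
  refine TensorProduct.ext' fun P h => ?_
  have h1 : aeval (tensorGen k .Y) P = P ⊗ₜ[k] (1 : Sweedler k) := by
    have : aeval (tensorGen k .Y) =
        (Algebra.TensorProduct.includeLeft : k[X] →ₐ[k] k[X] ⊗[k] Sweedler k) := by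
      ext; simp [tensorGen]
    rw [this]; rfl
  have h2 : sweedlerMap (tensorGen k .g) (tensorGen k .x) =
      TensorProduct.mk k k[X] (Sweedler k) 1 := by
    apply Sweedler.linearMap_ext <;> simp [tensorGen, Algebra.TensorProduct.one_def]
  simp [h1, h2]

variable (k p) in
/-- `A_(0)` is isomorphic to `k[Y] ⊗ H₄`. -/
def equivTensor : QAlg k p (0 : ℕ →₀ k) ≃ₐc[k] k[X] ⊗[k] Sweedler k :=
  (isModel_tensorGen k p).equiv (by
    rw [monomialMap_tensorGen]
    exact Function.bijective_id)

/-- The coordinate at `1` maps onto `k[Y]`. -/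
theorem not_finiteDimensional : ¬ FiniteDimensional k (QAlg k p α) := by
  intro h
  have h1 : Module.Finite k (k[X] ⊗[k] Sweedler k) :=
    Module.Finite.equiv (basisEquiv p α).toLinearEquiv.symm
  refine Polynomial.not_finite (R := k)
    (Module.Finite.of_surjective (Sweedler.coeffMap k k[X] 0) fun P => ⟨P ⊗ₜ[k] 1, ?_⟩)
  simp [Sweedler.coord_one]

/-! ### Coordinates, group-like and primitive elements of `A_((αᵢ))` -/

variable (p) in
/-- The coordinates of an element of `A_((αᵢ))`. -/
def coeff (i : Fin 4) : QAlg k p α →ₗ[k] k[X] :=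
  Sweedler.coeffMap k k[X] i ∘ₗ (basisEquiv p α).symm.toLinearEquiv.toLinearMap

theorem coeff_basisMap (i : Fin 4) (z : k[X] ⊗[k] Sweedler k) :
    coeff p α i (basisMap p α z) = Sweedler.coeffMap k k[X] i z :=
  congrArg (Sweedler.coeffMap k k[X] i) ((basisEquiv p α).symm_apply_apply z)

theorem coeff_aeval (i : Fin 4) (P : k[X]) :
    coeff p α i (aeval (gen k p α .Y) P) = if i = 0 then P else 0 := by
  have h : aeval (gen k p α .Y) P = basisMap p α (P ⊗ₜ[k] 1) := by simp [basisMap]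
  rw [h, coeff_basisMap]
  simp [Sweedler.coord_one]

theorem coeff_one (i : Fin 4) : coeff p α i 1 = if i = 0 then 1 else 0 := by
  simpa using coeff_aeval (p := p) α i 1

theorem coeff_g (i : Fin 4) : coeff p α i (gen k p α .g) = if i = 1 then 1 else 0 := by
  have h : gen k p α .g = basisMap p α (1 ⊗ₜ[k] Sweedler.g k) := by simp [basisMap]
  rw [h, coeff_basisMap]
  simp [Sweedler.coord_g]

theorem coeff_x (i : Fin 4) : coeff p α i (gen k p α .x) = if i = 2 then 1 else 0 := by
  have h : gen k p α .x = basisMap p α (1 ⊗ₜ[k] Sweedler.x k) := by simp [basisMap]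
  rw [h, coeff_basisMap]
  simp [Sweedler.coord_x]

theorem eq_sum_coeff (b : QAlg k p α) :
    b = aeval (gen k p α .Y) (coeff p α 0 b) +
      aeval (gen k p α .Y) (coeff p α 1 b) * gen k p α .g +
      aeval (gen k p α .Y) (coeff p α 2 b) * gen k p α .x +
      aeval (gen k p α .Y) (coeff p α 3 b) * (gen k p α .g * gen k p α .x) := by
  obtain ⟨z, rfl⟩ := basisMap_surjective (p := p) α b
  simp only [coeff_basisMap]
  conv_lhs => rw [Sweedler.eq_sum_coeffMap z]
  simp [basisMap]

theorem aeval_Y_injective : Function.Injective (aeval (R := k) (gen k p α .Y)) := by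
  intro P Q h
  simpa [coeff_aeval] using congrArg (coeff p α 0) h

theorem map_coeff_comul (i j : Fin 4) (b : QAlg k p α) :
    TensorProduct.map (coeff p α i) (coeff p α j) (comul (R := k) b) =
      if i = 0 ∧ j = 0 then comul (R := k) (coeff p α 0 b)
      else if i = 1 ∧ j = 1 then comul (R := k) (coeff p α 1 b)
      else if (i = 2 ∧ j = 0) ∨ (i = 1 ∧ j = 2) then comul (R := k) (coeff p α 2 b)
      else if (i = 3 ∧ j = 1) ∨ (i = 0 ∧ j = 3) then comul (R := k) (coeff p α 3 b)
      else 0 := by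
  obtain ⟨z, rfl⟩ := basisMap_surjective (p := p) α b
  have h : ∀ i, coeff p α i ∘ₗ basisMap p α = Sweedler.coeffMap k k[X] i :=
    fun i => LinearMap.ext (coeff_basisMap α i)
  rw [← map_basisMap_comul, TensorProduct.map_map, h, h, Sweedler.map_coeffMap_comul]
  simp only [coeff_basisMap]

theorem eq_zero_of_comul_eq_zero {P : k[X]} (h : comul (R := k) P = 0) : P = 0 :=
  comul_injective (h.trans (map_zero _).symm)

/-- The top coefficient of `P ⊗ P` is the square of the leading coefficient of `P`. -/
theorem tmul_self_eq_zero {P : k[X]} (h : P ⊗ₜ[k] P = 0) : P = 0 := by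
  by_contra hP
  have hn : TensorProduct.lid k k (TensorProduct.map (lcoeff k P.natDegree)
      (lcoeff k P.natDegree) (P ⊗ₜ[k] P)) = 0 := by rw [h]; simp
  simp [hP] at hn

/-- The group-like elements of `A_((αᵢ))`. -/
theorem eq_one_or_eq_g_of_isGroupLikeElem {b : QAlg k p α} (hb : IsGroupLikeElem k b) :
    b = 1 ∨ b = gen k p α .g := by
  -- Compare `bᵢ ⊗ bⱼ` with the components of `Δ b`. No coproduct has components at `(x, x)`, `(gx,
  -- gx)` or `(1, g)`, so `b₂ = b₃ = 0` and `b₀ ⊗ b₁ = 0`.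
  have key : ∀ i j, coeff p α i b ⊗ₜ[k] coeff p α j b = _ := fun i j => by
    rw [← TensorProduct.map_tmul, ← hb.comul_eq_tmul_self, map_coeff_comul α i j b]
  have h2 : coeff p α 2 b = 0 := tmul_self_eq_zero ((key 2 2).trans (by simp))
  have h3 : coeff p α 3 b = 0 := tmul_self_eq_zero ((key 3 3).trans (by simp))
  have h01 : coeff p α 0 b ⊗ₜ[k] coeff p α 1 b = 0 := (key 0 1).trans (by simp)
  have h00 : coeff p α 0 b ⊗ₜ[k] coeff p α 0 b = comul (R := k) (coeff p α 0 b) :=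
    (key 0 0).trans (by simp)
  have h11 : coeff p α 1 b ⊗ₜ[k] coeff p α 1 b = comul (R := k) (coeff p α 1 b) :=
    (key 1 1).trans (by simp)
  have hs := eq_sum_coeff α b
  rw [h2, h3, map_zero, zero_mul, zero_mul, add_zero, add_zero] at hs
  have hc : counit (R := k) (coeff p α 0 b) + counit (R := k) (coeff p α 1 b) = 1 := by
    have := hb.counit_eq_one
    rw [hs, map_add, Bialgebra.counit_mul, counit_aeval_Y, counit_aeval_Y, counit_gen] at this
    simpa [counitGen] using this
  have h01' : counit (R := k) (coeff p α 0 b) • coeff p α 1 b = 0 := by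
    simpa using congrArg (TensorProduct.lid k k[X] ∘ (counit (R := k)).rTensor k[X]) h01
  -- Since `ε(b₀) + ε(b₁) = 1`, in either case one of `b₀`, `b₁` has counit `1`, hence is group-like
  -- and equal to `1`, and the other vanishes.
  rcases smul_eq_zero.1 h01' with h | h
  · right
    rw [h, zero_add] at hc
    have h1 : coeff p α 1 b = 1 := eq_one_of_isGroupLikeElem ⟨hc, h11.symm⟩
    have h0 : coeff p α 0 b = 0 := by
      rw [h1] at h01
      simpa using congrArg (TensorProduct.rid k k[X] ∘ (counit (R := k)).lTensor k[X]) h01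
    rw [h0, h1] at hs
    simpa using hs
  · left
    rw [h, map_zero, add_zero] at hc
    have h0 : coeff p α 0 b = 1 := eq_one_of_isGroupLikeElem ⟨hc, h00.symm⟩
    rw [h0, h] at hs
    simpa using hs

/-- The primitive elements of `A_((αᵢ))` are polynomials in `Y`. -/
theorem exists_aeval_of_primitive {b : QAlg k p α}
    (hb : comul (R := k) b = b ⊗ₜ[k] 1 + 1 ⊗ₜ[k] b) :
    ∃ P : k[X], b = aeval (gen k p α .Y) P := by
  have key : ∀ i j, _ := fun i j =>
    (map_coeff_comul α i j b).symm.trans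
      (congrArg (TensorProduct.map (coeff p α i) (coeff p α j)) hb)
  simp only [map_add, TensorProduct.map_tmul, coeff_one] at key
  -- The components `(g, g)`, `(g, x)`, `(gx, g)` of `b ⊗ 1 + 1 ⊗ b` are zero, while those of `Δ b`
  -- are `Δ b₁`, `Δ b₂`, `Δ b₃`.
  have h1 : coeff p α 1 b = 0 := eq_zero_of_comul_eq_zero (by simpa using key 1 1)
  have h2 : coeff p α 2 b = 0 := eq_zero_of_comul_eq_zero (by simpa using key 1 2)
  have h3 : coeff p α 3 b = 0 := eq_zero_of_comul_eq_zero (by simpa using key 3 1)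
  have hs := eq_sum_coeff α b
  rw [h1, h2, h3] at hs
  exact ⟨_, by simpa using hs⟩

/-- The elements of `A_((αᵢ))` with `Δ(b) = b ⊗ 1 + g ⊗ b`. -/
theorem exists_smul_of_skewPrimitive {b : QAlg k p α}
    (hb : comul (R := k) b = b ⊗ₜ[k] 1 + gen k p α .g ⊗ₜ[k] b) :
    ∃ c d : k, b = c • (1 - gen k p α .g) + d • gen k p α .x := by
  have key : ∀ i j, _ := fun i j =>
    (map_coeff_comul α i j b).symm.trans
      (congrArg (TensorProduct.map (coeff p α i) (coeff p α j)) hb)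
  simp only [map_add, TensorProduct.map_tmul, coeff_one, coeff_g] at key
  obtain ⟨c, h0⟩ : ∃ c, coeff p α 0 b = C c :=
    ⟨_, eq_C_of_comul_eq_tmul_one (by simpa using key 0 0)⟩
  obtain ⟨d, h2⟩ : ∃ d, coeff p α 2 b = C d :=
    ⟨_, eq_C_of_comul_eq_tmul_one (by simpa using key 2 0)⟩
  have h3 : coeff p α 3 b = 0 := eq_zero_of_comul_eq_zero (by simpa using key 0 3)
  -- The `(g, 1)` component of `Δ b` is zero, which reads `b₁ ⊗ 1 + 1 ⊗ b₀ = 0`.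
  have h10 : coeff p α 1 b = -C c := by
    have h := congrArg (TensorProduct.rid k k[X] ∘ (counit (R := k)).lTensor k[X]) (key 1 0)
    have hc : counit (R := k) (C c) = c := Bialgebra.counit_algebraMap c
    refine eq_neg_of_add_eq_zero_left ?_
    rw [← mul_one (C c), C_mul']
    simpa [h0, hc] using h.symm
  have hs := eq_sum_coeff α b
  rw [h10, h3, h0, h2, map_neg, aeval_C, aeval_C, map_zero, zero_mul, add_zero] at hs
  refine ⟨c, d, hs.trans ?_⟩
  simp [Algebra.algebraMap_eq_smul_one, sub_eq_add_neg]

end QAlg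

/-! ### Isomorphisms between the Hopf algebras `A_((αᵢ))` -/

namespace QAlg

open Polynomial

variable {k : Type*} [Field k] {p : ℕ} {α β : ℕ →₀ k}

theorem aeval_smul_Y (β : ℕ →₀ k) (a : k) (P : k[X]) :
    aeval (a • gen k p β .Y) P = aeval (gen k p β .Y) (P.comp (C a * X)) := by
  rw [aeval_comp]
  simp [Algebra.smul_def]

theorem scale_symm {a b : kˣ} (h : ∀ i, (a : k) ^ p ^ i * α i = (b : k) ^ 2 * β i) (i : ℕ) :
    ((a⁻¹ : kˣ) : k) ^ p ^ i * β i = ((b⁻¹ : kˣ) : k) ^ 2 * α i := by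
  have ha : (a : k) ≠ 0 := a.ne_zero
  have hb : (b : k) ≠ 0 := b.ne_zero
  have := h i
  simp only [Units.val_inv_eq_inv_val, inv_pow]
  field_simp
  rw [mul_comm, ← this, mul_comm]

/-- Multiplying by `αᵢ` absorbs the condition `αᵢ ≠ 0`. Membership becomes the rescaling relation
between `α` and itself, the form in which automorphisms produce it. -/
theorem mem_seqGroup_iff {q : kˣ × kˣ} :
    q ∈ seqGroup p α ↔ ∀ i, (q.1 : k) ^ p ^ i * α i = (q.2 : k) ^ 2 * α i := by
  refine forall_congr' fun i => ?_
  rw [mul_eq_mul_right_iff, or_comm, or_iff_not_imp_left]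
  exact imp_congr_right fun _ => by rw [Units.ext_iff]; simp

theorem seqGroup_zero : seqGroup p (0 : ℕ →₀ k) = ⊤ := by
  ext q
  simp [mem_seqGroup_iff]

variable [hp : Fact p.Prime]

/-- Additive polynomials have coefficients only in degrees `p^j`, so the scalar conditions amount to
one identity of polynomials, which can be evaluated at `Y`. -/
theorem smul_eq_iff_comp_poly {a b : k} :
    (∀ i, a ^ p ^ i * α i = b ^ 2 * β i) ↔ (poly p α).comp (C a * X) = C (b ^ 2) * poly p β := by
  constructor
  · intro h
    ext n
    rw [comp_C_mul_X_coeff, coeff_C_mul]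
    by_cases hn : ∃ j, n = p ^ j
    · obtain ⟨j, rfl⟩ := hn
      rw [poly, poly, coeff_sum_X_pow_pow p hp.out.one_lt, coeff_sum_X_pow_pow p hp.out.one_lt,
        ← h, mul_comm]
    · push Not at hn
      rw [poly, poly, coeff_sum_X_pow_of_ne p _ hn, coeff_sum_X_pow_of_ne p _ hn, zero_mul,
        mul_zero]
  · intro h i
    have h1 := congrArg (fun P => Polynomial.coeff P (p ^ i)) h
    simp only [comp_C_mul_X_coeff, coeff_C_mul, poly] at h1
    rwa [coeff_sum_X_pow_pow p hp.out.one_lt, coeff_sum_X_pow_pow p hp.out.one_lt, mul_comm] at h1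

variable [CharP k p]

variable (p) in
/-- The elements `a Y`, `g`, `b x` of `A_((βᵢ))`. -/
def scaledGen (β : ℕ →₀ k) (a b : k) : QGen → QAlg k p β
  | .Y => a • gen k p β .Y
  | .g => gen k p β .g
  | .x => b • gen k p β .x

/-- The relation for `x²` is the only one that constrains `a` and `b`; the others are homogeneous in
`Y` and in `x`. -/
theorem isModel_scaledGen {a b : k} (h : ∀ i, a ^ p ^ i * α i = b ^ 2 * β i) :
    IsModel p α (scaledGen p β a b) where
  g_sq := g_sq β
  x_sq := by
    have hb := (isModel_gen (p := p) β).x_sq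
    simp only [scaledGen]
    rw [aeval_smul_Y, smul_eq_iff_comp_poly.1 h, smul_mul_smul_comm, hb, map_mul, aeval_C,
      Algebra.smul_def, pow_two]
  x_g := by simp [scaledGen, x_g]
  g_Y := by simp [scaledGen, g_Y]
  x_Y := by simp [scaledGen, x_Y, smul_smul, mul_comm]
  comul_Y := by simp [scaledGen, comul_Y, TensorProduct.smul_tmul']
  comul_g := comul_g β
  comul_x := by simp [scaledGen, comul_x, TensorProduct.smul_tmul']
  counit := by rintro (_ | _ | _) <;> simp [scaledGen, counit_gen, counitGen]

/-- The isomorphism `A_((αᵢ)) ≃ A_((βᵢ))` with `Y ↦ a Y`, `g ↦ g`, `x ↦ b x`. -/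
def scaleEquiv (a b : kˣ) (h : ∀ i, (a : k) ^ p ^ i * α i = (b : k) ^ 2 * β i) :
    QAlg k p α ≃ₐc[k] QAlg k p β :=
  BialgEquiv.ofBialgHom (isModel_scaledGen h).hom (isModel_scaledGen (scale_symm h)).hom
    (bialgHom_ext (by rintro (_ | _ | _) <;> simp [scaledGen, smul_smul]))
    (bialgHom_ext (by rintro (_ | _ | _) <;> simp [scaledGen, smul_smul]))

theorem scaleEquiv_gen (a b : kˣ) (h : ∀ i, (a : k) ^ p ^ i * α i = (b : k) ^ 2 * β i)
    (t : QGen) : scaleEquiv a b h (gen k p α t) = scaledGen p β a b t :=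
  (isModel_scaledGen h).hom_gen t

/-- Primitive elements go to primitive elements, so `ψ` and its inverse send `Y` to `P(Y)` and
`Q(Y)`. Then `Q ∘ P = Y` forces degree one, and the counit kills the constant term. -/
theorem map_Y (ψ : QAlg k p α ≃ₐc[k] QAlg k p β) :
    ∃ a : kˣ, ψ (gen k p α .Y) = (a : k) • gen k p β .Y := by
  have hex : ∀ {α β : ℕ →₀ k} (ψ : QAlg k p α ≃ₐc[k] QAlg k p β),
      ∃ P : k[X], ψ (gen k p α .Y) = aeval (gen k p β .Y) P := fun {α β} ψ => by
    apply exists_aeval_of_primitive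
    rw [← CoalgHomClass.map_comp_comul_apply, comul_Y]
    simp
  obtain ⟨P, hP⟩ := hex ψ
  obtain ⟨Q, hQ⟩ := hex ψ.symm
  have hQP : Q.comp P = X := by
    apply aeval_Y_injective (p := p) β
    rw [aeval_comp, ← hP, aeval_X]
    have h1 := aeval_algHom_apply (ψ : QAlg k p α →ₐ[k] QAlg k p β) (gen k p α .Y) Q
    refine h1.trans ?_
    rw [← hQ]
    exact ψ.apply_symm_apply _
  have hdeg : P.natDegree = 1 := by
    have h := congrArg natDegree hQP
    rw [natDegree_comp, natDegree_X] at h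
    exact Nat.eq_one_of_mul_eq_one_left h
  have h0 : P.coeff 0 = 0 := by
    have h : counit (R := k) (ψ (gen k p α .Y)) = 0 := by
      rw [CoalgHomClass.counit_comp_apply, counit_gen]; rfl
    rw [hP, counit_aeval_Y] at h
    rw [← h, coeff_zero_eq_aeval_zero]
    rfl
  have hP1 : P.coeff 1 ≠ 0 := by
    rw [← hdeg, coeff_natDegree, leadingCoeff_ne_zero]
    rintro rfl
    simp at hdeg
  refine ⟨Units.mk0 _ hP1, ?_⟩
  have h := eq_X_add_C_of_natDegree_le_one hdeg.le
  rw [h0, C_0, add_zero] at h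
  rw [hP, Units.val_mk0]
  conv_lhs => rw [h]
  simp [Algebra.smul_def]

/-- The group-like elements are `1` and `g`, and `1` is already the image of `1`. -/
theorem map_g (ψ : QAlg k p α ≃ₐc[k] QAlg k p β) : ψ (gen k p α .g) = gen k p β .g := by
  have hg : IsGroupLikeElem k (gen k p α .g) := ⟨counit_gen α .g, comul_g α⟩
  refine (eq_one_or_eq_g_of_isGroupLikeElem β (hg.map ψ)).resolve_left fun h => ?_
  have h1 : gen k p α .g = 1 := ψ.injective (h.trans (map_one ψ).symm)
  have h2 := congrArg (coeff p α 1) h1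
  simp [coeff_g, coeff_one] at h2

/-- The image of `x` is skew-primitive, so it is `c(1 - g) + dx`. It anticommutes with `g`, and the
coordinate at `1` of that relation says `2c = 0`; here odd characteristic enters. Injectivity gives
`d ≠ 0`. -/
theorem map_x (h2 : p ≠ 2) (ψ : QAlg k p α ≃ₐc[k] QAlg k p β) :
    ∃ b : kˣ, ψ (gen k p α .x) = (b : k) • gen k p β .x := by
  obtain ⟨c, d, h⟩ := exists_smul_of_skewPrimitive β (b := ψ (gen k p α .x)) (by
    rw [← CoalgHomClass.map_comp_comul_apply, comul_x, ← map_g ψ]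
    simp)
  have hxg := congrArg ψ (x_g (p := p) α)
  rw [map_neg, map_mul, map_mul, map_g, h] at hxg
  simp only [add_mul, mul_add, smul_mul_assoc, mul_smul_comm, sub_mul, mul_sub, one_mul, mul_one,
    g_sq, x_g, smul_neg] at hxg
  have hc : (2 : k) * c = 0 := by
    have h1 := congrArg (fun b => (coeff p β 0 b).coeff 0) hxg
    have hgx : coeff p β 0 (gen k p β .g * gen k p β .x) = 0 := by
      rw [show gen k p β .g * gen k p β .x =
        basisMap p β (1 ⊗ₜ[k] (Sweedler.g k * Sweedler.x k)) by simp [basisMap], coeff_basisMap,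
        Sweedler.coeffMap_tmul, Sweedler.coord_g_mul_x]
      simp
    simp [coeff_g, coeff_one, hgx] at h1
    linear_combination -h1
  have hc0 : c = 0 := by
    refine (mul_eq_zero.1 hc).resolve_left fun h => h2 ?_
    have h3 : ((2 : ℕ) : k) = 0 := by exact_mod_cast h
    rw [CharP.cast_eq_zero_iff k p] at h3
    exact (Nat.prime_dvd_prime_iff_eq hp.out Nat.prime_two).1 h3
  rw [hc0, zero_smul, zero_add] at h
  have hd : d ≠ 0 := by
    rintro rfl
    rw [zero_smul] at h
    have h3 : gen k p α .x = 0 := ψ.injective (h.trans (map_zero ψ).symm)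
    have h4 := congrArg (coeff p α 2) h3
    simp [coeff_x] at h4
  exact ⟨Units.mk0 d hd, h⟩

/-- Every isomorphism `A_((αᵢ)) ≃ A_((βᵢ))` rescales the generators `Y` and `x`. -/
theorem exists_eq_scaleEquiv (h2 : p ≠ 2) (ψ : QAlg k p α ≃ₐc[k] QAlg k p β) :
    ∃ (a b : kˣ) (h : ∀ i, (a : k) ^ p ^ i * α i = (b : k) ^ 2 * β i), ψ = scaleEquiv a b h := by
  obtain ⟨a, ha⟩ := map_Y ψ
  obtain ⟨b, hb⟩ := map_x h2 ψ
  have h : ∀ i, (a : k) ^ p ^ i * α i = (b : k) ^ 2 * β i := by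
    rw [smul_eq_iff_comp_poly (p := p)]
    apply aeval_Y_injective (p := p) β
    -- Applying `ψ` to `x² = Σ αᵢ Y^{pⁱ}` gives `Σ αᵢ (aY)^{pⁱ} = b² Σ βᵢ Y^{pⁱ}`.
    have h1 := aeval_algHom_apply (ψ : QAlg k p α →ₐ[k] QAlg k p β) (gen k p α .Y) (poly p α)
    rw [← (isModel_gen (p := p) α).x_sq] at h1
    have h3 : aeval (ψ (gen k p α .Y)) (poly p α) = ψ (gen k p α .x) * ψ (gen k p α .x) :=
      h1.trans (map_mul ψ _ _)
    rw [ha, hb, aeval_smul_Y, smul_mul_smul_comm, (isModel_gen (p := p) β).x_sq] at h3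
    rw [h3, map_mul, aeval_C, Algebra.smul_def, pow_two]
  refine ⟨a, b, h, bialgEquiv_ext fun t => ?_⟩
  rw [scaleEquiv_gen]
  rcases t with _ | _ | _
  · exact ha
  · exact map_g ψ
  · exact hb

theorem nonempty_equiv_iff (h2 : p ≠ 2) :
    Nonempty (QAlg k p α ≃ₐc[k] QAlg k p β) ↔ seqSetoid k p α β := by
  constructor
  · rintro ⟨ψ⟩
    obtain ⟨a, b, h, -⟩ := exists_eq_scaleEquiv h2 ψ
    exact ⟨a, b, h⟩
  · rintro ⟨a, b, h⟩
    exact ⟨scaleEquiv a b h⟩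

variable (p α) in
/-- The action of `G((αᵢ))` on `A_((αᵢ))`. -/
def seqGroupHom : seqGroup p α →* (QAlg k p α ≃ₐc[k] QAlg k p α) where
  toFun q := scaleEquiv q.1.1 q.1.2 (mem_seqGroup_iff.1 q.2)
  map_one' := bialgEquiv_ext (by
    rintro (_ | _ | _) <;> rw [scaleEquiv_gen] <;> simp [scaledGen] <;> rfl)
  map_mul' q r := bialgEquiv_ext (by
    intro t
    refine Eq.trans ?_ (congrArg (scaleEquiv q.1.1 q.1.2 (mem_seqGroup_iff.1 q.2))
      (scaleEquiv_gen r.1.1 r.1.2 (mem_seqGroup_iff.1 r.2) t).symm)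
    rw [scaleEquiv_gen]
    rcases t with _ | _ | _ <;> simp [scaledGen, scaleEquiv_gen, smul_smul, mul_comm])

/-- The scalars `a`, `b` are read off as coefficients of the images of `Y` and `x`; surjectivity is
`exists_eq_scaleEquiv`. -/
theorem seqGroupHom_bijective (h2 : p ≠ 2) : Function.Bijective (seqGroupHom p α) := by
  constructor
  · rintro ⟨⟨a, b⟩, hq⟩ ⟨⟨c, d⟩, hr⟩ h
    have hY : scaledGen p α (a : k) (b : k) .Y = scaledGen p α (c : k) (d : k) .Y := by
      rw [← scaleEquiv_gen a b (mem_seqGroup_iff.1 hq), ← scaleEquiv_gen c d (mem_seqGroup_iff.1 hr)]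
      exact DFunLike.congr_fun h _
    have hx : scaledGen p α (a : k) (b : k) .x = scaledGen p α (c : k) (d : k) .x := by
      rw [← scaleEquiv_gen a b (mem_seqGroup_iff.1 hq), ← scaleEquiv_gen c d (mem_seqGroup_iff.1 hr)]
      exact DFunLike.congr_fun h _
    have hac : (a : k) = c := by
      have h1 := congrArg (fun b => (coeff p α 0 b).coeff 1) hY
      have h3 : coeff p α 0 (gen k p α .Y) = X := by simpa using coeff_aeval (p := p) α 0 X
      simpa [scaledGen, h3] using h1
    have hbd : (b : k) = d := by
      have h1 := congrArg (fun b => (coeff p α 2 b).coeff 0) hx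
      simpa [scaledGen, coeff_x] using h1
    obtain rfl := Units.ext hac
    obtain rfl := Units.ext hbd
    rfl
  · intro ψ
    obtain ⟨a, b, h, rfl⟩ := exists_eq_scaleEquiv h2 ψ
    exact ⟨⟨(a, b), mem_seqGroup_iff.2 h⟩, rfl⟩

variable (α) in
/-- The automorphism group of `A_((αᵢ))` is `G((αᵢ))`. -/
def autEquiv (h2 : p ≠ 2) : (QAlg k p α ≃ₐc[k] QAlg k p α) ≃* seqGroup p α :=
  (MulEquiv.ofBijective (seqGroupHom p α) (seqGroupHom_bijective h2)).symm

end QAlg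

/-- Isomorphic bialgebras have isomorphic automorphism groups. -/
def BialgEquiv.autCongr {k A B : Type*} [CommSemiring k] [Semiring A] [Bialgebra k A] [Semiring B]
    [Bialgebra k B] (e : A ≃ₐc[k] B) : (A ≃ₐc[k] A) ≃* (B ≃ₐc[k] B) where
  toFun f := e.symm.trans (f.trans e)
  invFun f := e.trans (f.trans e.symm)
  left_inv f := BialgEquiv.ext fun a => by simp; rfl
  right_inv f := BialgEquiv.ext fun a => by simp; rfl
  map_mul' f g := BialgEquiv.ext fun a => congrArg (e ∘ f) (e.symm_apply_apply _).symm

/-! ### Classification of the crossed systems -/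

namespace CrossedSystem

open Polynomial

section Cohomologous

variable {k A H : Type*} [Field k] [Ring A] [HopfAlgebra k A] [Ring H] [HopfAlgebra k H]

theorem convMap_unit_counit {C : Type*} [AddCommGroup C] [Module k C] [Coalgebra k C]
    (φ : C →ₗ[k] A) : convMap (Algebra.linearMap k A ∘ₗ counit) φ = φ :=
  congrArg WithConv.ofConv (one_mul (WithConv.toConv φ))

theorem convMap_counit_unit {C : Type*} [AddCommGroup C] [Module k C] [Coalgebra k C]
    (φ : C →ₗ[k] A) : convMap φ (Algebra.linearMap k A ∘ₗ counit) = φ :=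
  congrArg WithConv.ofConv (mul_one (WithConv.toConv φ))

/-- If the only unitary cocentral map is trivial, then cohomologous crossed systems are equal. -/
theorem cohomologous_iff_eq (h : ∀ r : H →ₗc[k] A, IsCocentral r → r 1 = 1 →
      (r : H →ₗ[k] A) = Algebra.linearMap k A ∘ₗ counit)
    (r₀ : H →ₗc[k] A) (h₀ : IsCocentral r₀) (h₁ : r₀ 1 = 1) {S T : CrossedSystem k A H} :
    S.Cohomologous T ↔ S = T := by
  -- For `r = ε(·) 1` every factor of the two transformation formulas that contains `r` is a unit
  -- for convolution, which leaves the action and the cocycle unchanged.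
  have hS : HopfAlgebra.antipode k ∘ₗ Algebra.linearMap k A ∘ₗ counit (A := H) =
      Algebra.linearMap k A ∘ₗ counit := by
    ext a
    simp [Algebra.algebraMap_eq_smul_one]
  have hm : HopfAlgebra.antipode k ∘ₗ (Algebra.linearMap k A ∘ₗ counit (A := H)) ∘ₗ
      LinearMap.mul' k H = Algebra.linearMap k A ∘ₗ counit (A := H ⊗[k] H) := by
    ext a b
    simp [Algebra.algebraMap_eq_smul_one, mul_comm]
  have he : extendByCounit (Algebra.linearMap k A ∘ₗ counit (A := H)) =
      Algebra.linearMap k A ∘ₗ counit (A := H ⊗[k] H) := by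
    ext a b
    simp [Algebra.algebraMap_eq_smul_one, smul_smul]
  have ha : TensorProduct.lift (S.act.compl₂ (Algebra.linearMap k A ∘ₗ counit (A := H))) =
      Algebra.linearMap k A ∘ₗ counit (A := H ⊗[k] H) := by
    ext a b
    simp [Algebra.algebraMap_eq_smul_one, S.act_one, smul_smul]
  constructor
  · rintro ⟨r, hr, hr1, hact, hco⟩
    rw [h r hr hr1] at hco
    simp only [h r hr hr1] at hact
    refine CrossedSystem.ext ?_ ?_
    · ext b a
      have h3 := hact a
      rw [hS, convMap_counit_unit, convMap_unit_counit] at h3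
      exact (LinearMap.congr_fun h3 b).symm
    · rw [hco, he, ha, hm, convMap_counit_unit, convMap_unit_counit, convMap_unit_counit]
  · rintro rfl
    refine ⟨r₀, h₀, h₁, fun a => ?_, ?_⟩
    · rw [h r₀ h₀ h₁, hS, convMap_counit_unit, convMap_unit_counit]
    · rw [h r₀ h₀ h₁, he, ha, hm, convMap_counit_unit, convMap_unit_counit, convMap_unit_counit]

variable (k A H) in
/-- The coalgebra map `h ↦ ε(h) 1`. -/
def trivialCoalgHom : H →ₗc[k] A :=
  ((Bialgebra.unitBialgHom k A).comp (Bialgebra.counitBialgHom k H) : H →ₐc[k] A)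

theorem trivialCoalgHom_toLinearMap :
    (trivialCoalgHom k A H : H →ₗ[k] A) = Algebra.linearMap k A ∘ₗ counit := rfl

/-- By the two counit axioms both sides reduce to `1 ⊗ h`. -/
theorem isCocentral_trivialCoalgHom : IsCocentral (trivialCoalgHom k A H) := by
  intro h
  rw [trivialCoalgHom_toLinearMap, LinearMap.rTensor_comp, LinearMap.comp_apply,
    LinearMap.comp_apply, rTensor_counit_comul]
  congr 1
  have h1 : ∀ U : H ⊗[k] H, (counit (R := k)).rTensor H (TensorProduct.comm k H H U) =
      TensorProduct.comm k H k (counit.lTensor H U) := by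
    intro U
    induction U with
    | zero => simp
    | add U V hU hV => simp only [map_add, hU, hV]
    | tmul a b => simp
  rw [h1, lTensor_counit_comul]
  simp

theorem trivialCoalgHom_one : trivialCoalgHom k A H 1 = 1 :=
  map_one ((Bialgebra.unitBialgHom k A).comp (Bialgebra.counitBialgHom k H))

end Cohomologous

/-! ### Crossed systems on `k[Y]` and `H₄`: cohomology and parametrisation by sequences. -/

variable {k : Type*} [Field k]

/-- Every unitary cocentral map `H₄ → k[Y]` is trivial. -/
theorem eq_of_isCocentral {r : Sweedler k →ₗc[k] k[X]} (hr : IsCocentral r) (h1 : r 1 = 1) :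
    (r : Sweedler k →ₗ[k] k[X]) = Algebra.linearMap k k[X] ∘ₗ counit := by
  have hg : r (Sweedler.g k) = 1 := by
    refine eq_one_of_isGroupLikeElem (k := k) (IsGroupLikeElem.map r ⟨?_, ?_⟩)
    · exact Sweedler.counit_g k
    · exact Sweedler.comul_g k
  -- Cocentrality at `x` reads `r(x) ⊗ 1 + r(g) ⊗ x = r(1) ⊗ x + r(x) ⊗ g`; the coordinate at `1` is
  -- `r(x) = 0`. The same coordinate at `gx` gives `r(gx) = 0`.
  have hx : r (Sweedler.x k) = 0 := by
    have h := congrArg (Sweedler.coeffMap k k[X] 0) (hr (Sweedler.x k))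
    simpa [Sweedler.coord_one, Sweedler.coord_g, Sweedler.coord_x, h1] using h
  have hgx : r (Sweedler.g k * Sweedler.x k) = 0 := by
    have h := hr (Sweedler.g k * Sweedler.x k)
    rw [Sweedler.comul_g_mul_x] at h
    have h := congrArg (Sweedler.coeffMap k k[X] 0) h
    simpa [Sweedler.coord_one, Sweedler.coord_g, Sweedler.coord_g_mul_x, h1] using h.symm
  apply Sweedler.linearMap_ext
  · simpa using h1
  · simpa using hg
  · simpa using hx
  · simpa using hgx

theorem sweedler_cohomologous_iff_eq {S T : CrossedSystem k k[X] (Sweedler k)} :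
    S.Cohomologous T ↔ S = T :=
  cohomologous_iff_eq (fun _ => eq_of_isCocentral) (trivialCoalgHom k k[X] (Sweedler k))
    isCocentral_trivialCoalgHom trivialCoalgHom_one

variable (p : ℕ) [Fact p.Prime] [CharP k p]

theorem cocycle_crossedSystem (α : ℕ →₀ k) :
    (QAlg.crossedSystem p α).cocycle (Sweedler.x k ⊗ₜ[k] Sweedler.x k) = QAlg.poly p α := by
  simp [QAlg.crossedSystem, Sweedler.coord_x]

/-- The inverse takes `S` to the coefficients of `f(x, x)`, which is primitive, hence additive, and
which determines `S`. -/
theorem crossedSystem_bijective :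
    Function.Bijective fun α : ℕ →₀ k => QAlg.crossedSystem p α := by
  constructor
  · intro α β h
    apply sum_X_pow_pow_injective (k := k) p (Fact.out : p.Prime).one_lt
    have h1 := congrArg (fun S : CrossedSystem k k[X] (Sweedler k) =>
      S.cocycle (Sweedler.x k ⊗ₜ[k] Sweedler.x k)) h
    rw [cocycle_crossedSystem, cocycle_crossedSystem] at h1
    exact h1
  · intro S
    obtain ⟨α, hα⟩ := exists_eq_sum_of_primitive p S.comul_cocycle_x_x
    exact ⟨α, eq_of_cocycle_x_x ((cocycle_crossedSystem p α).trans hα.symm)⟩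

variable (k) in
/-- Crossed systems on `k[Y]` and `H₄` correspond to finitely supported sequences. -/
def seqEquiv : CrossedSystem k k[X] (Sweedler k) ≃ (ℕ →₀ k) :=
  (Equiv.ofBijective _ (crossedSystem_bijective p)).symm

theorem crossedSystem_seqEquiv (S : CrossedSystem k k[X] (Sweedler k)) :
    QAlg.crossedSystem p (seqEquiv k p S) = S :=
  (Equiv.ofBijective _ (crossedSystem_bijective p)).apply_symm_apply S

theorem seqEquiv_crossedSystem (α : ℕ →₀ k) :
    seqEquiv k p (QAlg.crossedSystem p α) = α :=
  (Equiv.ofBijective _ (crossedSystem_bijective p)).symm_apply_apply α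

theorem cocycle_x_x_eq (S : CrossedSystem k k[X] (Sweedler k)) :
    S.cocycle (Sweedler.x k ⊗ₜ[k] Sweedler.x k) = QAlg.poly p (seqEquiv k p S) := by
  conv_lhs => rw [← crossedSystem_seqEquiv p S, cocycle_crossedSystem]

/-- The generators `Y # 1`, `1 # g`, `1 # x` of a crossed product. -/
def elt (S : CrossedSystem k k[X] (Sweedler k)) : QGen → S.Product
  | .Y => S.eltY
  | .g => S.eltG
  | .x => S.eltX

theorem isModel_elt (S : CrossedSystem k k[X] (Sweedler k)) :
    QAlg.IsModel p (seqEquiv k p S) S.elt where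
  g_sq := S.eltG_mul_eltG
  x_sq := by
    rw [← cocycle_x_x_eq]
    exact S.eltX_mul_eltX.trans (S.aeval_eltY _).symm
  x_g := S.eltX_mul_eltG
  g_Y := S.eltG_mul_eltY
  x_Y := S.eltX_mul_eltY
  comul_Y := S.comul_eltY
  comul_g := S.comul_eltG
  comul_x := S.comul_eltX
  counit := by
    rintro (_ | _ | _)
    · exact (S.counit_tmul _ _).trans (by simp [QAlg.counitGen])
    · exact (S.counit_tmul _ _).trans (by simp [QAlg.counitGen])
    · exact (S.counit_tmul _ _).trans (by simp [QAlg.counitGen])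

/-- A crossed product of `k[Y]` and `H₄` is isomorphic to `A_((αᵢ))` with
`f(x, x) = Σ αᵢ Y^{pⁱ}`. -/
def productEquiv (S : CrossedSystem k k[X] (Sweedler k)) :
    QAlg k p (seqEquiv k p S) ≃ₐc[k] S.Product :=
  (isModel_elt p S).equiv (by
    have h : (monomialMap (S.elt .Y) (S.elt .g) (S.elt .x) : k[X] ⊗[k] Sweedler k → S.Product) =
        fun z => (show S.Product from z) := funext S.monomialMap_elt
    rw [h]
    exact Function.bijective_id)

end CrossedSystem

end

/-! ### The classification theorem. -/

theorem mainTheorem9 {k : Type*} [Field k] (p : ℕ) [Fact p.Prime] [CharP k p] (hp : 3 ≤ p) :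
    -- (1) description of the crossed products and of their automorphism groups
    ((∀ (E : Type*) [Ring E] [HopfAlgebra k E],
        (∃ S : CrossedSystem k k[X] (Sweedler k), Nonempty (E ≃ₐc[k] S.Product)) ↔
          ∃ α : ℕ →₀ k, Nonempty (E ≃ₐc[k] QAlg k p α)) ∧
      (∀ α : ℕ →₀ k, ¬ FiniteDimensional k (QAlg k p α)) ∧
      Nonempty (QAlg k p (0 : ℕ →₀ k) ≃ₐc[k] k[X] ⊗[k] Sweedler k) ∧
      Nonempty (((k[X] ⊗[k] Sweedler k) ≃ₐc[k] (k[X] ⊗[k] Sweedler k)) ≃* kˣ × kˣ) ∧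
      (∀ α : ℕ →₀ k, α ≠ 0 →
        Nonempty ((QAlg k p α ≃ₐc[k] QAlg k p α) ≃* seqGroup p α))) ∧
    -- (2) isomorphism types of crossed products; the bijection sends the type of `A_((αᵢ))` to the
    -- class of `(αᵢ)`
    (∃ e : Crp k k[X] (Sweedler k) ≃ Quotient (seqSetoid k p),
      ∀ (S : CrossedSystem k k[X] (Sweedler k)) (α : ℕ →₀ k),
        e (Quotient.mk _ S) = Quotient.mk _ α ↔ Nonempty (S.Product ≃ₐc[k] QAlg k p α)) ∧
    -- (3) cohomology classes; the bijection sends the class of `(▹, f)` to the sequence `(αᵢ)` with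
    -- `f(x, x) = Σ αᵢ Y^{pⁱ}`
    (Equivalence (CrossedSystem.Cohomologous (k := k) (A := k[X]) (H := Sweedler k)) ∧
      ∃ e : CohomH2 k k[X] (Sweedler k) ≃ (ℕ →₀ k),
        ∀ S : CrossedSystem k k[X] (Sweedler k),
          S.cocycle (Sweedler.x k ⊗ₜ[k] Sweedler.x k) =
            (e (Quot.mk _ S)).sum fun i c => c • (Polynomial.X : k[X]) ^ p ^ i) := by
  have h2 : p ≠ 2 := by omega
  have hiso : ∀ (S : CrossedSystem k k[X] (Sweedler k)) (α : ℕ →₀ k),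
      Nonempty (S.Product ≃ₐc[k] QAlg k p α) ↔
        seqSetoid k p (CrossedSystem.seqEquiv k p S) α := by
    intro S α
    rw [← QAlg.nonempty_equiv_iff h2]
    exact ⟨fun ⟨e⟩ => ⟨(CrossedSystem.productEquiv p S).trans e⟩,
      fun ⟨e⟩ => ⟨(CrossedSystem.productEquiv p S).symm.trans e⟩⟩
  refine ⟨⟨?_, QAlg.not_finiteDimensional, ⟨QAlg.equivTensor k p⟩, ?_, fun α _ =>
    ⟨QAlg.autEquiv α h2⟩⟩, ?_, ?_, ?_⟩
  · intro E _ _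
    constructor
    · rintro ⟨S, ⟨e⟩⟩
      exact ⟨_, ⟨e.trans (CrossedSystem.productEquiv p S).symm⟩⟩
    · rintro ⟨α, ⟨e⟩⟩
      have e' := CrossedSystem.productEquiv p (QAlg.crossedSystem p α)
      rw [CrossedSystem.seqEquiv_crossedSystem] at e'
      exact ⟨QAlg.crossedSystem p α, ⟨e.trans e'⟩⟩
  -- Automorphisms of `k[Y] ⊗ H₄` are those of `A_(0)`, and `G(0)` imposes no condition on `(a, b)`.
  · exact ⟨(QAlg.equivTensor k p).autCongr.symm.trans ((QAlg.autEquiv 0 h2).trans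
      ((MulEquiv.subgroupCongr QAlg.seqGroup_zero).trans Subgroup.topEquiv))⟩
  -- The bijection between crossed systems and sequences descends, since isomorphism of products
  -- matches `∼` by `hiso`.
  · refine ⟨Quotient.congr (CrossedSystem.seqEquiv k p) fun S T => ?_, fun S α => ?_⟩
    · change Nonempty (S.Product ≃ₐc[k] T.Product) ↔ _
      refine Iff.trans ?_ (hiso S (CrossedSystem.seqEquiv k p T))
      exact ⟨fun ⟨e⟩ => ⟨e.trans (CrossedSystem.productEquiv p T).symm⟩,
        fun ⟨e⟩ => ⟨e.trans (CrossedSystem.productEquiv p T)⟩⟩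
    · exact Quotient.eq.trans (hiso S α).symm
  · have h : CrossedSystem.Cohomologous (k := k) (A := k[X]) (H := Sweedler k) = Eq := by
      ext S T
      exact CrossedSystem.sweedler_cohomologous_iff_eq
    rw [h]
    exact eq_equivalence
  · refine ⟨{
      toFun := Quot.lift (CrossedSystem.seqEquiv k p) fun S T h =>
        congrArg _ (CrossedSystem.sweedler_cohomologous_iff_eq.1 h)
      invFun := fun α => Quot.mk _ ((CrossedSystem.seqEquiv k p).symm α)
      left_inv := by
        rintro ⟨S⟩
        exact congrArg (Quot.mk _) ((CrossedSystem.seqEquiv k p).symm_apply_apply S)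
      right_inv := fun α => by simp }, fun S => CrossedSystem.cocycle_x_x_eq p S⟩
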